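/- Let $a$ be a positive prime and let $b > 1$ and $c > 0$ be integers. Then the equation $a^x - b^y = c$ has at most two solutions in nonnegative integers $(x,y)$, except for $(a,b,c) = (2,5,3)$, for which the solutions are exactly $(x,y) = (2,0)$, $(3,1)$, $(7,3)$. Moreover, there are infinitely many triples $(a,b,c)$, with $a$ a positive prime and $b>1$, $c>0$ integers, for which the equation has exactly two solutions in nonnegative integers $(x,y)$. -/

import Mathlib

/-!
A solution of `p ^ x - b ^ y = c` with `p ∤ b` and `c > 1` is an element `b ^ z √A + √(-c)` of norm
`p ^ x`, where `A` is `1` or `b` according to the parity of `y`.  Suppose there are two solutions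
`y₁ < y₂ = y₁ + 2d` of the same parity with `y₁ > 0`; put `A = b ^ y₁`.  The prime `p` splits, and
both `α = √A + √(-c)` and `b ^ d √A + √(-c)` generate powers of the same prime over `p`; dividing by
`α` or its conjugate as long as possible shows that the second is, up to sign and conjugation, an
odd power `α ^ n` (`descent`, `eq_oddPow_of_norm`).  No class group is needed: a remainder of norm
less than that of `α` would be too small to exist.  For `p = 2` everything is divided by `2` (this
is the parameter `τ`), since the relevant ring contains half-integral elements.

The coefficient of `√A` in `α ^ n` is `∑ C(n, 2i+1) Aⁱ (-c) ^ ((n-1)/2 - i)`, in which the term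
`i = 0` dominates `q`-adically for every prime `q ∣ A`, except when `q = 3` exactly divides `A`
(`pow_dvd_of_pow_dvd_oddPow_fst`).  Hence `b ^ d ∣ n`, which is far too small compared with the norm
of `α ^ n` unless that of `α` is `2`; this gives `(2, 5, 3)`.  If `3` exactly divides `A`, then
`3 ∣ n` and the argument is repeated with `α ^ 3` in place of `α`; this gives `(13, 3, 10)`,
`(2, 3, 13)` and `(2, 3, 5)` (`same_parity_classification`).

Three solutions therefore consist, apart from these triples, of `y = 0`, a positive even `y` and an
odd `y` (`false_of_zero_even_odd`).  Here `c = p ^ s - 1`.  For `p = 2` this contradicts the `2`-adic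
valuations of `b ^ y - 1`.  For odd `p` the even solution gives `(1 + √(-c)) ^ n = ±b ^ z ± √(-c)`
with `n` odd; congruences modulo `4`, the `2`-adic behaviour of the powers
(`oddPow_one_snd_ne_one`) and finally quadratic reciprocity for `b ≡ p ≡ 3 (mod 4)` exclude it.

If `p ∣ b` there is at most one solution, and `c = 1` is settled by lifting the exponent.
-/

/-! ### Descent for the norm forms -/

/-- The pair of integers `(R, I)` with `(√A + √(-c)) ^ (2 * k + 1) = R * √A + I * √(-c)`, defined by
repeated multiplication by `(√A + √(-c)) ^ 2 = A - c + 2 * √A * √(-c)`. -/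
def oddPow (A c : ℤ) : ℕ → ℤ × ℤ
  | 0 => (1, 1)
  | k + 1 => ((A - c) * (oddPow A c k).1 - 2 * c * (oddPow A c k).2,
      (A - c) * (oddPow A c k).2 + 2 * A * (oddPow A c k).1)

lemma dvd_sub_or_dvd_add_of_dvd_sq_sub_sq {p h : ℕ} (hp : p.Prime) {τ u v : ℤ}
    (hτ : p ≠ 2 ∧ τ = 1 ∨ p = 2 ∧ τ = 2) (hu : ¬ (p : ℤ) ∣ u) (hv : ¬ (p : ℤ) ∣ v)
    (hd : τ ^ 2 * (p : ℤ) ^ h ∣ u ^ 2 - v ^ 2) :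
    τ * (p : ℤ) ^ h ∣ u - v ∨ τ * (p : ℤ) ^ h ∣ u + v := by
  have hpi : Prime (p : ℤ) := Nat.prime_iff_prime_int.mp hp
  rcases hτ with ⟨h2, rfl⟩ | ⟨rfl, rfl⟩
  · have hd' : (p : ℤ) ^ h ∣ (u - v) * (u + v) := by
      have e : u ^ 2 - v ^ 2 = (u - v) * (u + v) := by ring
      rw [e] at hd; simpa using hd
    by_cases h1 : (p : ℤ) ∣ u + v
    · have h3 : ¬ (p : ℤ) ∣ u - v := by
        intro h3
        have h4 : (p : ℤ) ∣ 2 * u := by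
          have := dvd_add h1 h3
          rwa [show u + v + (u - v) = 2 * u by ring] at this
        rcases hpi.dvd_or_dvd h4 with h5 | h5
        · exact h2 ((Nat.prime_dvd_prime_iff_eq hp Nat.prime_two).mp (by exact_mod_cast h5))
        · exact hu h5
      right
      rw [one_mul]
      exact (((Prime.coprime_iff_not_dvd hpi).mpr h3).pow_left).dvd_of_dvd_mul_left hd'
    · left
      rw [one_mul]
      exact (((Prime.coprime_iff_not_dvd hpi).mpr h1).pow_left).dvd_of_dvd_mul_right hd'
  · push_cast at *
    obtain ⟨a, rfl⟩ : Odd u := Int.not_even_iff_odd.mp fun h => hu h.two_dvd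
    obtain ⟨b, rfl⟩ : Odd v := Int.not_even_iff_odd.mp fun h => hv h.two_dvd
    have hd' : (2 : ℤ) ^ h ∣ (a - b) * (a + b + 1) := by
      have e : (2 * a + 1) ^ 2 - (2 * b + 1) ^ 2 = 2 ^ 2 * ((a - b) * (a + b + 1)) := by ring
      rw [e] at hd
      exact (mul_dvd_mul_iff_left (by norm_num)).mp hd
    have e1 : 2 * a + 1 - (2 * b + 1) = 2 * (a - b) := by ring
    have e2 : 2 * a + 1 + (2 * b + 1) = 2 * (a + b + 1) := by ring
    rw [e1, e2]
    by_cases h1 : (2 : ℤ) ∣ a - b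
    · left
      have h3 : ¬ (2 : ℤ) ∣ a + b + 1 := by omega
      exact mul_dvd_mul_left _
        ((((Prime.coprime_iff_not_dvd hpi).mpr h3).pow_left).dvd_of_dvd_mul_right hd')
    · right
      exact mul_dvd_mul_left _
        ((((Prime.coprime_iff_not_dvd hpi).mpr h1).pow_left).dvd_of_dvd_mul_left hd')

section Descent

variable {p h : ℕ} {τ A c : ℤ}

lemma not_dvd_of_norm_odd (hp : p.Prime) (hpA : ¬ (p : ℤ) ∣ A) {m : ℕ} (hm : 0 < m) {X Y : ℤ}
    (hX : ¬ (p : ℤ) ∣ X) (e : A * X ^ 2 + c * Y ^ 2 = τ ^ 2 * (p : ℤ) ^ m) : ¬ (p : ℤ) ∣ Y := by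
  have hpi : Prime (p : ℤ) := Nat.prime_iff_prime_int.mp hp
  intro hY
  have h1 : (p : ℤ) ∣ A * X ^ 2 := by
    have : A * X ^ 2 = τ ^ 2 * (p : ℤ) ^ m - c * Y ^ 2 := by linarith
    rw [this]
    exact dvd_sub (Dvd.dvd.mul_left (dvd_pow_self _ hm.ne') _)
      (Dvd.dvd.mul_left (Dvd.dvd.pow hY two_ne_zero) _)
  rcases hpi.dvd_or_dvd h1 with h2 | h2
  · exact hpA h2
  · exact hX (hpi.dvd_of_dvd_pow h2)

/-- If `p ∣ X` in a pair of norm `τ² p ^ m`, then also `p ∣ Y`, and moreover `X / 2 ≡ Y / 2 (mod 2)`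
when `p = τ = 2`.  So `p` divides `(X + u * Y) / τ`: a multiple of a non-primitive element is not
primitive. -/
lemma dvd_of_norm_of_dvd (hp : p.Prime) (hτ : p ≠ 2 ∧ τ = 1 ∨ p = 2 ∧ τ = 2) {a b u : ℤ}
    (ha : ¬ (p : ℤ) ∣ a) (hb : ¬ (p : ℤ) ∣ b) (hu : ¬ (p : ℤ) ∣ u) {m : ℕ} (hm : 0 < m)
    {X Y z : ℤ} (hX : (p : ℤ) ∣ X) (e : a * X ^ 2 + b * Y ^ 2 = τ ^ 2 * (p : ℤ) ^ m)
    (hz : τ * z = X + u * Y) : (p : ℤ) ∣ z := by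
  have hY : (p : ℤ) ∣ Y := by
    by_contra hY
    exact not_dvd_of_norm_odd (τ := τ) (A := b) (c := a) (X := Y) (Y := X) hp hb hm hY
      (by linarith) hX
  rcases hτ with ⟨h2, rfl⟩ | ⟨rfl, rfl⟩
  · rw [one_mul] at hz
    rw [hz]
    exact dvd_add hX (hY.mul_left _)
  · obtain ⟨x, rfl⟩ := hX
    obtain ⟨y, rfl⟩ := hY
    obtain ⟨n, rfl⟩ := Nat.exists_eq_add_of_le' hm
    push_cast at *
    have e' : a * x ^ 2 + b * y ^ 2 = 2 * 2 ^ n := by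
      have : 4 * (a * x ^ 2 + b * y ^ 2) = 4 * (2 * 2 ^ n) := by
        rw [pow_succ 2 n] at e; linarith
      linarith
    have hz' : z = x + u * y := by linarith
    have ha' : ¬ Even a := fun h => ha h.two_dvd
    have hb' : ¬ Even b := fun h => hb h.two_dvd
    have hu' : ¬ Even u := fun h => hu h.two_dvd
    have h3 : Even (a * x ^ 2 + b * y ^ 2) := ⟨2 ^ n, by rw [e']; ring⟩
    have h4 : Even z := by
      rw [hz']
      simpa [Int.even_add, Int.even_mul, Int.even_pow, ha', hb', hu'] using h3
    exact h4.two_dvd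

lemma isCoprime_sq_mul_pow (hp : p.Prime) (hτ : p ≠ 2 ∧ τ = 1 ∨ p = 2 ∧ τ = 2)
    (hpA : ¬ (p : ℤ) ∣ A) (h : ℕ) : IsCoprime (τ ^ 2 * (p : ℤ) ^ h) A := by
  have h3 : IsCoprime (p : ℤ) A :=
    (Prime.coprime_iff_not_dvd (Nat.prime_iff_prime_int.mp hp)).mpr hpA
  refine IsCoprime.mul_left ?_ h3.pow_left
  rcases hτ with ⟨-, rfl⟩ | ⟨rfl, rfl⟩
  · simpa using isCoprime_one_left
  · exact_mod_cast h3.pow_left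

/-- Descent: up to sign, a primitive element `X√A + Y√(-c)` of norm `τ² p ^ m` in the right residue
class is an odd power of `√A + √(-c)` (divided by a power of `τ`), and likewise a primitive element
`X + Y√(-Ac)` is an even power.  Each step divides by `√A + √(-c)` and passes between the two kinds.
When `A = 1` they have the same shape and are told apart by the parity of `Y`. -/
theorem descent (hp : p.Prime) (hτ : p ≠ 2 ∧ τ = 1 ∨ p = 2 ∧ τ = 2) (hh : 0 < h) (hA : 0 < A)
    (hc : 1 < c) (hpA : ¬ (p : ℤ) ∣ A) (hpc : ¬ (p : ℤ) ∣ c) (hN : A + c = τ ^ 2 * (p : ℤ) ^ h)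
    (hA1 : A = 1 → Even c) (m : ℕ) : 0 < m →
    (∀ X Y : ℤ, ¬ (p : ℤ) ∣ X → A * X ^ 2 + c * Y ^ 2 = τ ^ 2 * (p : ℤ) ^ m →
      τ * (p : ℤ) ^ h ∣ X - Y → (A = 1 → Odd Y) →
      ∃ k : ℕ, ∃ ε : ℤ, (ε = 1 ∨ ε = -1) ∧ m = (2 * k + 1) * h ∧
        τ ^ (2 * k) * X = ε * (oddPow A c k).1 ∧ τ ^ (2 * k) * Y = ε * (oddPow A c k).2) ∧
    (∀ X Y : ℤ, ¬ (p : ℤ) ∣ X → X ^ 2 + A * c * Y ^ 2 = τ ^ 2 * (p : ℤ) ^ m →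
      τ * (p : ℤ) ^ h ∣ X + c * Y → (A = 1 → Even Y) →
      ∃ k : ℕ, ∃ ε : ℤ, (ε = 1 ∨ ε = -1) ∧ m = (2 * k + 2) * h ∧
        τ ^ (2 * k + 1) * X = ε * (A * (oddPow A c k).1 - c * (oddPow A c k).2) ∧
        τ ^ (2 * k + 1) * Y = ε * ((oddPow A c k).1 + (oddPow A c k).2)) := by
  have hpi : Prime (p : ℤ) := Nat.prime_iff_prime_int.mp hp
  have hp2 : (2 : ℤ) ≤ p := by exact_mod_cast hp.two_le
  have hτ0 : 0 < τ := by omega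
  have hτ1 : τ ≠ 0 := hτ0.ne'
  have hq0 : (0 : ℤ) < (p : ℤ) ^ h := by positivity
  have hpAc : ¬ (p : ℤ) ∣ A * c := fun hd => (hpi.dvd_or_dvd hd).elim hpA hpc
  have hp1 : ¬ (p : ℤ) ∣ 1 := hpi.not_dvd_one
  have hlt : ∀ {j : ℕ}, j < h → τ ^ 2 * (p : ℤ) ^ j < τ ^ 2 * (p : ℤ) ^ h := fun hj =>
    mul_lt_mul_of_pos_left (pow_lt_pow_right₀ (by linarith) hj) (by positivity)
  have hsq : ∀ {x : ℤ}, ¬ (p : ℤ) ∣ x → 1 ≤ x ^ 2 := fun {x} hx => by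
    have : x ≠ 0 := fun h0 => hx (h0 ▸ dvd_zero _)
    have := sq_pos_of_ne_zero this
    omega
  -- an odd prime forces `c ≥ 2`, and for `p = 2` both `A` and `c` are odd and at least `3`
  have hcase : (τ = 1 ∧ p ≠ 2) ∨ (p = 2 ∧ τ = 2 ∧ 3 ≤ A ∧ 3 ≤ c) := by
    rcases hτ with ⟨h2, h3⟩ | ⟨h2, h3⟩
    · exact Or.inl ⟨h3, h2⟩
    · right
      subst h2
      push_cast at hpA hpc
      have : A ≠ 1 := fun h1 => hpc (hA1 h1).two_dvd
      refine ⟨rfl, h3, ?_, ?_⟩ <;> omega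
  induction m using Nat.strong_induction_on with
  | _ m ih =>
  intro hm
  constructor
  · intro X Y hX e hXY hpar
    have hY := not_dvd_of_norm_odd hp hpA hm hX e
    have hmh : h ≤ m := by
      by_contra hlt'
      have h1 := hlt (not_le.mp hlt')
      nlinarith [hsq hX, hsq hY]
    obtain ⟨y, hy⟩ := hXY
    obtain ⟨j, rfl⟩ := Nat.exists_eq_add_of_le hmh
    obtain rfl : X = Y + τ * (p : ℤ) ^ h * y := by linarith
    -- the quotient by `(√A + √(-c)) / τ` is `τ * Y + A * y + (-y)√(-Ac)`
    have e' : (τ * Y + A * y) ^ 2 + A * c * (-y) ^ 2 = τ ^ 2 * (p : ℤ) ^ j := by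
      have : (p : ℤ) ^ h * ((τ * Y + A * y) ^ 2 + A * c * (-y) ^ 2) =
          (p : ℤ) ^ h * (τ ^ 2 * (p : ℤ) ^ j) := by
        rw [pow_add] at e
        linear_combination e + ((p : ℤ) ^ h * A * y ^ 2 - Y ^ 2) * hN
      exact mul_left_cancel₀ hq0.ne' this
    have hx : τ * (Y + τ * (p : ℤ) ^ h * y) = (τ * Y + A * y) - c * (-y) := by
      linear_combination -y * hN
    have hy' : τ * Y = A * (-y) + (τ * Y + A * y) := by ring
    rcases Nat.eq_zero_or_pos j with rfl | hj
    · have hy0 : y = 0 := by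
        by_contra hy0
        have h1 : 1 ≤ y ^ 2 := by have := sq_pos_of_ne_zero hy0; omega
        have h2 : τ ^ 2 < A * c := by
          rcases hcase with ⟨rfl, -⟩ | ⟨-, rfl, h3, h4⟩ <;> nlinarith
        nlinarith [sq_nonneg (τ * Y + A * y)]
      subst hy0
      have h1 : Y ^ 2 = 1 := by
        have : τ ^ 2 * Y ^ 2 = τ ^ 2 * 1 := by linear_combination e'
        exact mul_left_cancel₀ (by positivity) this
      refine ⟨0, Y, by simpa using h1, by simp, by simp [oddPow], by simp [oddPow]⟩
    · have hx' : ¬ (p : ℤ) ∣ τ * Y + A * y := fun hd =>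
        hY (dvd_of_norm_of_dvd hp hτ (a := 1) (b := A * c) (u := A) (Y := -y) hp1 hpAc hpA hj hd
          (by linarith) (by linarith))
      have hy'' : ¬ (p : ℤ) ∣ (-y) := not_dvd_of_norm_odd (τ := τ) (A := 1) (c := A * c) hp
        hp1 hj hx' (by linarith)
      have hcy : ¬ (p : ℤ) ∣ c * -y := fun hd => (hpi.dvd_or_dvd hd).elim hpc hy''
      have hdvd : τ * (p : ℤ) ^ h ∣ (τ * Y + A * y) + c * (-y) := by
        rcases Nat.lt_or_ge j h with hjh | hjh
        · exfalso
          have h1 := hlt hjh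
          nlinarith [hsq hx', hsq hy'', mul_nonneg (sub_nonneg.mpr (show 1 ≤ A by omega))
            (sub_nonneg.mpr hc.le), mul_pos hA (show 0 < c by omega)]
        · have h0 : τ ^ 2 * (p : ℤ) ^ h ∣ (τ * Y + A * y) ^ 2 - (c * -y) ^ 2 := by
            have h1 : (τ * Y + A * y) ^ 2 - (c * -y) ^ 2 =
                τ ^ 2 * (p : ℤ) ^ j - τ ^ 2 * (p : ℤ) ^ h * (c * y ^ 2) := by
              linear_combination e' - c * y ^ 2 * hN
            rw [h1]
            exact dvd_sub (mul_dvd_mul_left _ (pow_dvd_pow _ hjh)) (dvd_mul_right _ _)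
          rcases dvd_sub_or_dvd_add_of_dvd_sq_sub_sq hp hτ hx' hcy h0 with h1 | h1
          -- in the other residue class, the product `(X, Y)` would be divisible by `p ^ h`
          · exfalso
            rw [← hx] at h1
            exact hX ((dvd_pow_self _ hh.ne').trans ((mul_dvd_mul_iff_left hτ1).mp h1))
          · exact h1
      have hpar' : A = 1 → Even (-y) := by
        intro h1
        have hc2 := hA1 h1
        have hY' := hpar h1
        subst h1
        rcases hcase with ⟨rfl, h2⟩ | ⟨-, -, h2, -⟩
        · have hpo : Odd (p : ℤ) := by exact_mod_cast hp.odd_of_ne_two h2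
          have h3 : Odd (1 * (Y + 1 * (p : ℤ) ^ h * y) ^ 2 + c * Y ^ 2) := by
            rw [e]; simpa using hpo.pow
          rw [even_neg]
          simpa [Int.odd_add, Int.odd_pow, Int.even_add, Int.even_mul, Int.even_pow, hc2,
            hh.ne', ← Int.not_odd_iff_even, hY', hpo, Int.odd_mul, hm.ne'] using h3
        · omega
      obtain ⟨k, ε, hε, hk, h1, h2⟩ := (ih j (by omega) hj).2 _ _ hx' e' hdvd hpar'
      refine ⟨k + 1, ε, hε, by rw [hk]; ring, ?_, ?_⟩
      · simp only [oddPow]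
        rw [show τ ^ (2 * (k + 1)) = τ ^ (2 * k + 1) * τ by ring, mul_assoc, hx]
        linear_combination h1 - c * h2
      · simp only [oddPow]
        rw [show τ ^ (2 * (k + 1)) = τ ^ (2 * k + 1) * τ by ring, mul_assoc]
        linear_combination h1 + A * h2
  · intro X Y hX e hXY hpar
    have hY := not_dvd_of_norm_odd (τ := τ) (A := 1) (c := A * c) (Y := Y) hp hp1 hm hX (by linarith)
    have hmh : h ≤ m := by
      by_contra hlt'
      have h1 := hlt (not_le.mp hlt')
      nlinarith [hsq hX, hsq hY, mul_nonneg (sub_nonneg.mpr (show 1 ≤ A by omega))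
            (sub_nonneg.mpr hc.le), mul_pos hA (show 0 < c by omega)]
    obtain ⟨t, ht⟩ := hXY
    obtain ⟨j, rfl⟩ := Nat.exists_eq_add_of_le hmh
    obtain rfl : X = τ * (p : ℤ) ^ h * t - c * Y := by linarith
    -- the quotient by `(√A + √(-c)) / τ` is `t√A + (τ * Y - t)√(-c)`
    have e' : A * t ^ 2 + c * (τ * Y - t) ^ 2 = τ ^ 2 * (p : ℤ) ^ j := by
      have : (p : ℤ) ^ h * (A * t ^ 2 + c * (τ * Y - t) ^ 2) =
          (p : ℤ) ^ h * (τ ^ 2 * (p : ℤ) ^ j) := by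
        rw [pow_add] at e
        linear_combination e + ((p : ℤ) ^ h * t ^ 2 - c * Y ^ 2) * hN
      exact mul_left_cancel₀ hq0.ne' this
    have hx : τ * (τ * (p : ℤ) ^ h * t - c * Y) = A * t - c * (τ * Y - t) := by
      linear_combination -t * hN
    have hy' : τ * Y = t + (τ * Y - t) := by ring
    have hpar' : A = 1 → Odd (τ * Y - t) := by
      intro h1
      have hc2 := hA1 h1
      have hY' := hpar h1
      subst h1
      rcases hcase with ⟨rfl, h2⟩ | ⟨-, -, h2, -⟩
      · have hpo : Odd (p : ℤ) := by exact_mod_cast hp.odd_of_ne_two h2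
        have h3 : Odd ((1 * (p : ℤ) ^ h * t - c * Y) ^ 2 + 1 * c * Y ^ 2) := by
          rw [e]; simpa using hpo.pow
        simpa [Int.odd_add, Int.odd_sub, Int.even_sub, Int.even_add, Int.even_mul, Int.even_pow,
          hc2, hh.ne', ← Int.not_even_iff_odd, hY', hp.odd_of_ne_two h2, Int.odd_mul, hm.ne'] using h3
      · omega
    rcases Nat.eq_zero_or_pos j with rfl | hj
    -- a unit `t√A + (τ * Y - t)√(-c)` does not exist, by size, or by parity if `A = 1`
    · exfalso
      rw [pow_zero, mul_one] at e'
      have hA2 : A = 1 ∨ 2 ≤ A := by omega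
      by_cases h1 : t = 0
      · subst h1
        have h2 : (τ * Y - 0) ^ 2 = τ ^ 2 * Y ^ 2 := by ring
        have h3 : c * Y ^ 2 = 1 := by
          have : τ ^ 2 * (c * Y ^ 2) = τ ^ 2 * 1 := by linear_combination e'
          exact mul_left_cancel₀ (by positivity) this
        nlinarith [hsq hY]
      · have h1' : 1 ≤ t ^ 2 := by have := sq_pos_of_ne_zero h1; omega
        by_cases h2 : τ * Y - t = 0
        · rw [h2] at e'
          rcases hA2 with h3 | h3
          · have := hpar' h3
            rw [h2] at this
            exact absurd this (by decide)
          · rcases hcase with ⟨rfl, -⟩ | ⟨-, rfl, h3, h4⟩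
            · nlinarith
            · have ht2 : t = 2 * Y := by linarith
              rw [ht2] at e'
              nlinarith [hsq hY]
        · have h2' : 1 ≤ (τ * Y - t) ^ 2 := by have := sq_pos_of_ne_zero h2; omega
          rcases hcase with ⟨rfl, -⟩ | ⟨-, rfl, h3, h4⟩ <;> nlinarith
    · have ht' : ¬ (p : ℤ) ∣ t := fun hd => by
        have h1 : (p : ℤ) ∣ Y :=
          dvd_of_norm_of_dvd hp hτ (a := A) (b := c) (u := 1) hpA hpc hp1 hj hd e' (by linarith)
        exact hY h1
      have hy'' := not_dvd_of_norm_odd hp hpA hj ht' e'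
      have hdvd : τ * (p : ℤ) ^ h ∣ t - (τ * Y - t) := by
        rcases Nat.lt_or_ge j h with hjh | hjh
        · exfalso
          have h1 := hlt hjh
          nlinarith [hsq ht', hsq hy'']
        · have h0 : τ ^ 2 * (p : ℤ) ^ h ∣ t ^ 2 - (τ * Y - t) ^ 2 := by
            have h1 : A * (t ^ 2 - (τ * Y - t) ^ 2) =
                τ ^ 2 * (p : ℤ) ^ j - τ ^ 2 * (p : ℤ) ^ h * (τ * Y - t) ^ 2 := by
              linear_combination e' - (τ * Y - t) ^ 2 * hN
            have h2 : τ ^ 2 * (p : ℤ) ^ h ∣ A * (t ^ 2 - (τ * Y - t) ^ 2) := by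
              rw [h1]
              exact dvd_sub (mul_dvd_mul_left _ (pow_dvd_pow _ hjh)) (dvd_mul_right _ _)
            exact (isCoprime_sq_mul_pow hp hτ hpA h).dvd_of_dvd_mul_left h2
          rcases dvd_sub_or_dvd_add_of_dvd_sq_sub_sq hp hτ ht' hy'' h0 with h1 | h1
          · exact h1
          · exfalso
            rw [← hy'] at h1
            exact hY ((dvd_pow_self _ hh.ne').trans ((mul_dvd_mul_iff_left hτ1).mp h1))
      obtain ⟨k, ε, hε, hk, h1, h2⟩ := (ih j (by omega) hj).1 _ _ ht' e' hdvd hpar'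
      refine ⟨k, ε, hε, by rw [hk]; ring, ?_, ?_⟩
      · rw [show τ ^ (2 * k + 1) = τ ^ (2 * k) * τ by ring, mul_assoc, hx]
        linear_combination A * h1 - c * h2
      · rw [show τ ^ (2 * k + 1) = τ ^ (2 * k) * τ by ring, mul_assoc]
        rw [hy']
        linear_combination h1 + h2

end Descent

/-! ### Divisibility properties of the odd powers -/

lemma sq_add_pow_odd {S : Type*} [CommRing S] (s t : S) (k : ℕ) :
    (s + t) ^ (2 * k + 1) =
      s * ∑ i ∈ Finset.range (k + 1),
        ((2 * k + 1).choose (2 * i + 1) : S) * (s ^ 2) ^ i * (t ^ 2) ^ (k - i) +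
      t * ∑ i ∈ Finset.range (k + 1),
        ((2 * k + 1).choose (2 * i) : S) * (s ^ 2) ^ i * (t ^ 2) ^ (k - i) := by
  have split : ∀ (f : ℕ → S) (n : ℕ), ∑ m ∈ Finset.range (2 * n), f m =
      ∑ i ∈ Finset.range n, (f (2 * i + 1) + f (2 * i)) := by
    intro f n
    induction n with
    | zero => simp
    | succ n ih =>
      rw [show 2 * (n + 1) = 2 * n + 1 + 1 by ring, Finset.sum_range_succ, Finset.sum_range_succ,
        ih, Finset.sum_range_succ]
      ring
  rw [add_pow, show 2 * k + 1 + 1 = 2 * (k + 1) by ring, split, Finset.sum_add_distrib,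
    Finset.mul_sum, Finset.mul_sum]
  congr 1 <;> refine Finset.sum_congr rfl fun i hi => ?_
  · rw [show 2 * k + 1 - (2 * i + 1) = 2 * (k - i) by omega]
    ring
  · have : i ≤ k := Nat.lt_succ_iff.mp (Finset.mem_range.mp hi)
    rw [show 2 * k + 1 - 2 * i = 2 * (k - i) + 1 by omega]
    ring

lemma add_pow_eq_oddPow {S : Type*} [CommRing S] {s t : S} {A c : ℤ} (hs : s ^ 2 = A)
    (ht : t ^ 2 = -c) (k : ℕ) :
    (s + t) ^ (2 * k + 1) = s * (oddPow A c k).1 + t * (oddPow A c k).2 := by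
  induction k with
  | zero => simp [oddPow]
  | succ k ih =>
    rw [show 2 * (k + 1) + 1 = 2 * k + 1 + 2 by ring, pow_add, ih]
    simp only [oddPow]
    push_cast
    linear_combination (s * (oddPow A c k).1 + t * (oddPow A c k).2 + 2 * t * (oddPow A c k).1) * hs
      + (s * (oddPow A c k).1 + t * (oddPow A c k).2 + 2 * s * (oddPow A c k).2) * ht

lemma exists_sq_eq_of_ne_zero {A c : ℤ} (hA : A ≠ 0) (hc : c ≠ 0) :
    ∃ s t : ℂ, s ^ 2 = A ∧ t ^ 2 = -c ∧ s ≠ 0 ∧ t ≠ 0 := by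
  obtain ⟨s, hs⟩ := IsAlgClosed.exists_pow_nat_eq (A : ℂ) two_pos
  obtain ⟨t, ht⟩ := IsAlgClosed.exists_pow_nat_eq (-c : ℂ) two_pos
  refine ⟨s, t, hs, ht, ?_, ?_⟩
  · rintro rfl
    exact hA (by exact_mod_cast (by simpa using hs.symm : (A : ℂ) = 0))
  · rintro rfl
    exact hc (by exact_mod_cast (by simpa using ht.symm : (c : ℂ) = 0))

lemma oddPow_fst_eq_sum {A c : ℤ} (hA : A ≠ 0) (hc : c ≠ 0) (k : ℕ) :
    (oddPow A c k).1 = ∑ i ∈ Finset.range (k + 1),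
      ((2 * k + 1).choose (2 * i + 1) : ℤ) * A ^ i * (-c) ^ (k - i) := by
  obtain ⟨s, t, hs, ht, hs0, -⟩ := exists_sq_eq_of_ne_zero hA hc
  have ht' : (-t) ^ 2 = -(c : ℂ) := by rw [neg_sq, ht]
  have e1 := add_pow_eq_oddPow hs ht k
  have e2 := add_pow_eq_oddPow hs ht' k
  rw [sq_add_pow_odd, hs, ht] at e1
  rw [sq_add_pow_odd, hs, ht'] at e2
  have e3 : (2 * s) * ((oddPow A c k).1 : ℂ) = (2 * s) * ∑ i ∈ Finset.range (k + 1),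
      ((2 * k + 1).choose (2 * i + 1) : ℂ) * (A : ℂ) ^ i * (-c : ℂ) ^ (k - i) := by
    linear_combination -e1 - e2
  have e4 := mul_left_cancel₀ (mul_ne_zero two_ne_zero hs0) e3
  exact_mod_cast e4

/-- Both coefficients are divisibility sequences, as `α ^ (n * m) = (α ^ n) ^ m`. -/
lemma oddPow_comp {A c : ℤ} (hA : A ≠ 0) (hc : c ≠ 0) (i j k : ℕ)
    (hk : 2 * k + 1 = (2 * i + 1) * (2 * j + 1)) :
    (oddPow A c i).1 ∣ (oddPow A c k).1 ∧ (oddPow A c i).2 ∣ (oddPow A c k).2 := by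
  obtain ⟨s, t, hs, ht, hs0, ht0⟩ := exists_sq_eq_of_ne_zero hA hc
  set A' := A * (oddPow A c i).1 ^ 2
  set c' := c * (oddPow A c i).2 ^ 2
  have key : ∀ t : ℂ, t ^ 2 = -c →
      s * (oddPow A c k).1 + t * (oddPow A c k).2 =
      s * ((oddPow A c i).1 * (oddPow A' c' j).1) + t * ((oddPow A c i).2 * (oddPow A' c' j).2) := by
    intro t ht
    have h1 : (s * (oddPow A c i).1) ^ 2 = (A' : ℂ) := by
      rw [mul_pow, hs]; push_cast [A']; rfl
    have h2 : (t * (oddPow A c i).2) ^ 2 = -(c' : ℂ) := by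
      rw [mul_pow, ht]; push_cast [c']; ring
    rw [← add_pow_eq_oddPow hs ht k, hk, pow_mul, add_pow_eq_oddPow hs ht i,
      add_pow_eq_oddPow h1 h2 j]
    ring
  have e1 := key t ht
  have e2 := key (-t) (by rw [neg_sq, ht])
  constructor
  · have e3 : (2 * s) * ((oddPow A c k).1 : ℂ) =
        (2 * s) * ((oddPow A c i).1 * (oddPow A' c' j).1) := by linear_combination e1 + e2
    have e4 := mul_left_cancel₀ (mul_ne_zero two_ne_zero hs0) e3
    exact ⟨(oddPow A' c' j).1, by exact_mod_cast e4⟩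
  · have e3 : (2 * t) * ((oddPow A c k).2 : ℂ) =
        (2 * t) * ((oddPow A c i).2 * (oddPow A' c' j).2) := by linear_combination e1 - e2
    have e4 := mul_left_cancel₀ (mul_ne_zero two_ne_zero ht0) e3
    exact ⟨(oddPow A' c' j).2, by exact_mod_cast e4⟩

lemma dvd_oddPow_fst_sub {A c : ℤ} (hA : A ≠ 0) (hc : c ≠ 0) {k : ℕ} {d : ℤ}
    (hd : ∀ i, 0 < i → i ≤ k → d ∣ ((2 * k + 1).choose (2 * i + 1) : ℤ) * A ^ i) :
    d ∣ (oddPow A c k).1 - (2 * k + 1) * (-c) ^ k := by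
  rw [oddPow_fst_eq_sum hA hc, Finset.sum_range_succ']
  simp only [mul_zero, zero_add, Nat.choose_one_right, pow_zero, mul_one, Nat.sub_zero]
  push_cast
  rw [add_sub_cancel_right]
  refine Finset.dvd_sum fun i hi => Dvd.dvd.mul_right ?_ _
  exact hd (i + 1) i.succ_pos (Finset.mem_range.mp hi)

lemma dvd_oddPow_fst_sub_self {A c : ℤ} (hA : A ≠ 0) (hc : c ≠ 0) (k : ℕ) :
    A ∣ (oddPow A c k).1 - (2 * k + 1) * (-c) ^ k :=
  dvd_oddPow_fst_sub hA hc fun _ hi _ => Dvd.dvd.mul_left (dvd_pow_self _ hi.ne') _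

/-- The exponent of `q` in `R` is at most its exponent in `2 * k + 1`: in the expansion
`R = ∑ C(2k+1, 2i+1) Aⁱ (-c)^(k-i)` the term `i = 0` is the only one of minimal `q`-adic valuation,
unless `q = 3` exactly divides `A`. -/
lemma pow_dvd_of_pow_dvd_oddPow_fst {A c : ℤ} (hA : A ≠ 0) (hc : c ≠ 0) {q : ℕ} (hq : q.Prime)
    (hqA : (q : ℤ) ∣ A) (hqc : ¬ (q : ℤ) ∣ c) (h3 : q = 3 → (9 : ℤ) ∣ A) {k e : ℕ}
    (he : (q : ℤ) ^ e ∣ (oddPow A c k).1) : q ^ e ∣ 2 * k + 1 := by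
  have hqi : Prime (q : ℤ) := Nat.prime_iff_prime_int.mp hq
  obtain ⟨f, u, hu, hfu⟩ := Nat.exists_eq_pow_mul_and_not_dvd (n := 2 * k + 1) (by omega) q hq.ne_one
  by_contra hcon
  have hfe : f + 1 ≤ e := by
    by_contra hlt
    exact hcon ((pow_dvd_pow q (by omega)).trans (hfu ▸ dvd_mul_right _ _))
  have hterm : ∀ i, 0 < i → i ≤ k →
      (q : ℤ) ^ (f + 1) ∣ ((2 * k + 1).choose (2 * i + 1) : ℤ) * A ^ i := by
    intro i hi hik
    obtain ⟨g, v, hv, hgv⟩ :=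
      Nat.exists_eq_pow_mul_and_not_dvd (n := 2 * i + 1) (by omega) q hq.ne_one
    have h1 : (q : ℤ) ^ (g + 1) ∣ A ^ i := by
      have hle : q ^ g ≤ 2 * i + 1 := Nat.le_of_dvd (by omega) (hgv ▸ dvd_mul_right _ _)
      rcases Nat.lt_or_ge q 3 with hq3 | hq3
      · have hq2 : q = 2 := by have := hq.two_le; omega
        subst hq2
        have hg : g = 0 := by
          by_contra hg
          have : 2 ∣ 2 * i + 1 := hgv ▸ Dvd.dvd.mul_right (dvd_pow_self _ hg) _
          omega
        subst hg
        simpa using dvd_pow hqA hi.ne'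
      · by_cases hq3' : q = 3
        · subst hq3'
          have h9 : 2 * i + 1 < 3 ^ (2 * i) := by
            clear * - hi
            induction i, hi using Nat.le_induction with
            | base => norm_num
            | succ n hn ih => rw [show 2 * (n + 1) = 2 * n + 2 by ring, pow_add]; omega
          have hg : g < 2 * i := (Nat.pow_lt_pow_iff_right (by norm_num)).mp (hle.trans_lt h9)
          refine (pow_dvd_pow _ hg).trans ?_
          rw [pow_mul]
          exact pow_dvd_pow_of_dvd (by simpa using h3 rfl) i
        · have hq5 : 5 ≤ q := by
            by_contra hlt
            have : q = 4 := by omega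
            subst this
            exact absurd hq (by decide)
          have h5 : 2 * i + 1 < 5 ^ i := by
            clear * - hi
            induction i, hi using Nat.le_induction with
            | base => norm_num
            | succ n hn ih => rw [pow_succ]; omega
          have hg : g < i := (Nat.pow_lt_pow_iff_right (by omega : 1 < q)).mp
            (hle.trans_lt (h5.trans_le (Nat.pow_le_pow_left hq5 i)))
          exact (pow_dvd_pow _ hg).trans (pow_dvd_pow_of_dvd hqA i)
    have h2 : (q : ℤ) ^ f ∣ (q : ℤ) ^ g * ((2 * k + 1).choose (2 * i + 1) : ℤ) := by
      have h3 : q ^ f ∣ (2 * k + 1).choose (2 * i + 1) * (2 * i + 1) := by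
        rw [← Nat.add_one_mul_choose_eq (2 * k) (2 * i)]
        exact Dvd.dvd.mul_right (hfu ▸ dvd_mul_right _ _) _
      rw [hgv, ← mul_assoc] at h3
      rw [← hgv] at h3
      have hcop := Nat.Coprime.pow_left f ((Nat.Prime.coprime_iff_not_dvd hq).mpr hv)
      have h4 := hcop.dvd_of_dvd_mul_right h3
      rw [mul_comm] at h4
      exact_mod_cast h4
    rw [pow_succ] at h1 ⊢
    have h4 := mul_dvd_mul h2 (dvd_refl (q : ℤ))
    obtain ⟨w, hw⟩ := h1
    obtain ⟨z, hz⟩ := h4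
    refine ⟨z * w, ?_⟩
    rw [hw]
    linear_combination w * hz
  have h1 := dvd_oddPow_fst_sub hA hc hterm
  have h2 : (q : ℤ) ^ (f + 1) ∣ (2 * k + 1) * (-c) ^ k :=
    (dvd_sub_right ((pow_dvd_pow _ hfe).trans he)).mp h1
  have h3 : IsCoprime ((q : ℤ) ^ (f + 1)) ((-c) ^ k) :=
    (((Prime.coprime_iff_not_dvd hqi).mpr hqc).neg_right).pow
  have h4 : q ^ (f + 1) ∣ 2 * k + 1 := by
    have := h3.dvd_of_dvd_mul_right h2
    exact_mod_cast this
  rw [hfu, pow_succ] at h4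
  exact hu (Nat.dvd_of_mul_dvd_mul_left (pow_pos hq.pos f) h4)

/-! ### Two solutions of the same parity -/

/-- The descent for `X√A + √(-c)`, where `p ^ h ∣ X ^ 2 - 1` puts `X` or `-X` into the right residue
class. -/
lemma eq_oddPow_of_norm {p h m : ℕ} {τ A c X : ℤ} (hp : p.Prime)
    (hτ : p ≠ 2 ∧ τ = 1 ∨ p = 2 ∧ τ = 2) (hh : 0 < h) (hA : 0 < A)
    (hc : 1 < c) (hpA : ¬ (p : ℤ) ∣ A) (hpc : ¬ (p : ℤ) ∣ c) (hN : A + c = τ ^ 2 * (p : ℤ) ^ h)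
    (hA1 : A = 1 → Even c) (hpX : ¬ (p : ℤ) ∣ X) (e : A * X ^ 2 + c = τ ^ 2 * (p : ℤ) ^ m) :
    ∃ k : ℕ, ∃ ε δ : ℤ, (ε = 1 ∨ ε = -1) ∧ (δ = 1 ∨ δ = -1) ∧ m = (2 * k + 1) * h ∧
      τ ^ (2 * k) * X = ε * (oddPow A c k).1 ∧ τ ^ (2 * k) = δ * (oddPow A c k).2 := by
  have hpi : Prime (p : ℤ) := Nat.prime_iff_prime_int.mp hp
  have hp2 : (1 : ℤ) < p := by exact_mod_cast hp.one_lt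
  have hτ0 : 0 < τ := by omega
  have hX0 : 1 ≤ X ^ 2 := by
    have : X ≠ 0 := fun h0 => hpX (h0 ▸ dvd_zero _)
    have := sq_pos_of_ne_zero this
    omega
  have hhm : h ≤ m := by
    have h1 : τ ^ 2 * (p : ℤ) ^ h ≤ τ ^ 2 * (p : ℤ) ^ m := by rw [← hN, ← e]; nlinarith
    exact (pow_le_pow_iff_right₀ hp2).mp (le_of_mul_le_mul_left h1 (by positivity))
  have hd : τ ^ 2 * (p : ℤ) ^ h ∣ X ^ 2 - 1 ^ 2 := by
    refine (isCoprime_sq_mul_pow hp hτ hpA h).dvd_of_dvd_mul_left ?_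
    rw [show A * (X ^ 2 - 1 ^ 2) = τ ^ 2 * (p : ℤ) ^ m - τ ^ 2 * (p : ℤ) ^ h by
      linear_combination e - hN]
    exact dvd_sub (mul_dvd_mul_left _ (pow_dvd_pow _ hhm)) dvd_rfl
  have hm : 0 < m := by omega
  have main := (descent hp hτ hh hA hc hpA hpc hN hA1 m hm).1
  rcases dvd_sub_or_dvd_add_of_dvd_sq_sub_sq hp hτ hpX hpi.not_dvd_one hd with h1 | h1
  · obtain ⟨k, ε, hε, hk, h2, h3⟩ := main X 1 hpX (by linarith) h1 fun _ => odd_one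
    exact ⟨k, ε, ε, hε, hε, hk, h2, by linarith⟩
  · obtain ⟨k, ε, hε, hk, h2, h3⟩ := main (-X) 1 (by rwa [dvd_neg]) (by linarith)
      (by rw [show -X - 1 = -(X + 1) by ring, dvd_neg]; exact h1) fun _ => odd_one
    exact ⟨k, -ε, ε, by omega, hε, hk, by linarith, by linarith⟩

lemma two_or_of_pow_lt {N n : ℕ} (hN : 2 ≤ N) (hn : 3 ≤ n) (hodd : Odd n)
    (hlt : N ^ n < n ^ 2 * N) : N = 2 ∧ (n = 3 ∨ n = 5) := by
  obtain ⟨l, rfl⟩ := hodd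
  have hlt' : N ^ (2 * l) < (2 * l + 1) ^ 2 := by
    rw [pow_succ] at hlt
    exact lt_of_mul_lt_mul_right hlt (by omega)
  have h2 : N = 2 := by
    by_contra hne
    have h3 : (2 * l + 1) ^ 2 ≤ 3 ^ (2 * l) := by
      have : 1 ≤ l := by omega
      clear * - this
      induction l, this using Nat.le_induction with
      | base => norm_num
      | succ l hl ih => rw [show 2 * (l + 1) = 2 * l + 2 by ring, pow_add]; nlinarith
    have := Nat.pow_le_pow_left (show 3 ≤ N by omega) (2 * l)
    omega
  subst h2
  refine ⟨rfl, ?_⟩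
  by_contra hne
  have h3 : (2 * l + 1) ^ 2 ≤ 2 ^ (2 * l) := by
    have : 3 ≤ l := by omega
    clear * - this
    induction l, this using Nat.le_induction with
    | base => norm_num
    | succ l hl ih => rw [show 2 * (l + 1) = 2 * l + 2 by ring, pow_add]; nlinarith
  omega

/-- If every prime of `X` divides `A`, then `X` divides the exponent `n` with
`X√A + √(-c) ~ (√A + √(-c)) ^ n`, and comparing sizes leaves only norm `2`. -/
lemma small_of_prime_factors_dvd {p h m X : ℕ} {τ A c : ℤ} (hp : p.Prime)
    (hτ : p ≠ 2 ∧ τ = 1 ∨ p = 2 ∧ τ = 2) (hh : 0 < h) (hA : 0 < A)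
    (hc : 1 < c) (hpA : ¬ (p : ℤ) ∣ A) (hpc : ¬ (p : ℤ) ∣ c) (hN : A + c = τ ^ 2 * (p : ℤ) ^ h)
    (hX : 1 < X)
    (hq : ∀ q : ℕ, q.Prime → q ∣ X → (q : ℤ) ∣ A ∧ ¬ (q : ℤ) ∣ c ∧ (q = 3 → (9 : ℤ) ∣ A))
    (e : A * (X : ℤ) ^ 2 + c = τ ^ 2 * (p : ℤ) ^ m) :
    p ^ h = 2 ∧ (X ∣ 3 ∨ X ∣ 5) := by
  have hτ0 : 0 < τ := by omega
  have hA1 : A = 1 → Even c := by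
    rintro rfl
    obtain ⟨q, hqp, hqX⟩ := Nat.exists_prime_and_dvd hX.ne'
    exact absurd (hq q hqp hqX).1 (Nat.prime_iff_prime_int.mp hqp).not_dvd_one
  have hpX : ¬ (p : ℤ) ∣ (X : ℤ) := fun hd => hpA (hq p hp (by exact_mod_cast hd)).1
  obtain ⟨k, ε, δ, hε, -, hk, h1, -⟩ := eq_oddPow_of_norm hp hτ hh hA hc hpA hpc hN hA1 hpX e
  have hXR : (X : ℤ) ∣ (oddPow A c k).1 := by
    refine ⟨ε * τ ^ (2 * k), ?_⟩
    have : ε * ε = 1 := by rcases hε with rfl | rfl <;> norm_num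
    linear_combination -ε * h1 - (oddPow A c k).1 * this
  have hXn : X ∣ 2 * k + 1 := by
    rw [Nat.dvd_iff_prime_pow_dvd_dvd]
    intro q j hqp hj
    rcases Nat.eq_zero_or_pos j with rfl | hj0
    · simp
    obtain ⟨h2, h3, h4⟩ := hq q hqp ((dvd_pow_self q hj0.ne').trans hj)
    refine pow_dvd_of_pow_dvd_oddPow_fst hA.ne' (by omega) hqp h2 h3 h4 (dvd_trans ?_ hXR)
    exact_mod_cast hj
  have hXle : X ≤ 2 * k + 1 := Nat.le_of_dvd (by omega) hXn
  have hlt : (p ^ h) ^ (2 * k + 1) < (2 * k + 1) ^ 2 * p ^ h := by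
    have h2 : τ ^ 2 * ((p : ℤ) ^ h) ^ (2 * k + 1) < τ ^ 2 * ((2 * k + 1) ^ 2 * (p : ℤ) ^ h) := by
      rw [← pow_mul, mul_comm h, ← hk, ← e,
        show τ ^ 2 * ((2 * k + 1) ^ 2 * (p : ℤ) ^ h) = (A + c) * (2 * k + 1) ^ 2 by rw [hN]; ring]
      have h3 : (X : ℤ) ≤ 2 * k + 1 := by exact_mod_cast hXle
      have h4 : (2 : ℤ) ≤ X := by exact_mod_cast hX
      have h5 : (X : ℤ) ^ 2 ≤ (2 * k + 1) ^ 2 := pow_le_pow_left₀ (by omega) h3 2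
      have h6 : c * 1 < c * (2 * k + 1) ^ 2 := mul_lt_mul_of_pos_left (by nlinarith) (by omega)
      linarith [mul_le_mul_of_nonneg_left h5 hA.le]
    have h3 := lt_of_mul_lt_mul_left h2 (by positivity)
    exact_mod_cast h3
  obtain ⟨h2, h3⟩ := two_or_of_pow_lt (hp.two_le.trans (Nat.le_self_pow hh.ne' p))
    (show 3 ≤ 2 * k + 1 by omega) ⟨k, rfl⟩ hlt
  rcases h3 with h3 | h3
  · exact ⟨h2, Or.inl (by rwa [h3] at hXn)⟩
  · exact ⟨h2, Or.inr (by rwa [h3] at hXn)⟩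

/-- If `3` exactly divides `A`, the exponent is a multiple of `3`; then already
`(√A + √(-c)) ^ 3 = τ² (r√A ± √(-c))`, where `r ∣ X`. -/
lemma exists_cube_of_three_dvd {p h m : ℕ} {τ A c X : ℤ} (hp : p.Prime)
    (hτ : p ≠ 2 ∧ τ = 1 ∨ p = 2 ∧ τ = 2) (hh : 0 < h) (hA : 0 < A)
    (hc : 1 < c) (hpA : ¬ (p : ℤ) ∣ A) (hpc : ¬ (p : ℤ) ∣ c) (hN : A + c = τ ^ 2 * (p : ℤ) ^ h)
    (h3A : (3 : ℤ) ∣ A) (h3c : ¬ (3 : ℤ) ∣ c) (h3X : (3 : ℤ) ∣ X) (hpX : ¬ (p : ℤ) ∣ X)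
    (e : A * X ^ 2 + c = τ ^ 2 * (p : ℤ) ^ m) :
    ∃ r : ℤ, A - 3 * c = τ ^ 2 * r ∧ (3 * A - c = τ ^ 2 ∨ 3 * A - c = -τ ^ 2) ∧ r ∣ X ∧
      A * r ^ 2 + c = τ ^ 2 * (p : ℤ) ^ (3 * h) := by
  have h3i : Prime (3 : ℤ) := Int.prime_three
  have hτ0 : 0 < τ := by omega
  have hA1 : A = 1 → Even c := by rintro rfl; norm_num at h3A
  obtain ⟨k, ε, δ, hε, hδ, hk, h1, h2⟩ := eq_oddPow_of_norm hp hτ hh hA hc hpA hpc hN hA1 hpX e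
  have hεε : ε * ε = 1 := by rcases hε with rfl | rfl <;> norm_num
  have hδδ : δ * δ = 1 := by rcases hδ with rfl | rfl <;> norm_num
  have hR : (oddPow A c k).1 = ε * (τ ^ (2 * k) * X) := by
    linear_combination -ε * h1 - (oddPow A c k).1 * hεε
  have hI : (oddPow A c k).2 = δ * τ ^ (2 * k) := by
    linear_combination -δ * h2 - (oddPow A c k).2 * hδδ
  have h3n : (3 : ℤ) ∣ 2 * k + 1 := by
    have h4 := h3A.trans (dvd_oddPow_fst_sub_self hA.ne' (show c ≠ 0 by omega) k)
    have h5 : (3 : ℤ) ∣ (2 * k + 1) * (-c) ^ k :=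
      (dvd_sub_right (hR ▸ (h3X.mul_left _).mul_left _)).mp h4
    rcases h3i.dvd_or_dvd h5 with h6 | h6
    · exact h6
    · exact absurd ((dvd_neg).mp (h3i.dvd_of_dvd_pow h6)) h3c
  obtain ⟨j, hj⟩ : ∃ j, 2 * k + 1 = (2 * 1 + 1) * (2 * j + 1) := ⟨(k - 1) / 3, by omega⟩
  obtain ⟨h4, h5⟩ := oddPow_comp hA.ne' (show c ≠ 0 by omega) 1 j k hj
  rw [hR] at h4
  rw [hI] at h5
  have hu : ∀ {x y : ℤ}, ∀ {η : ℤ}, (η = 1 ∨ η = -1) → x ∣ η * y → x ∣ y := by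
    rintro x y η (rfl | rfl) hd
    · simpa using hd
    · simpa using hd
  replace h4 := hu hε h4
  replace h5 := hu hδ h5
  simp only [oddPow] at h4 h5
  obtain ⟨r, hr, hrX, hI1⟩ : ∃ r : ℤ, A - 3 * c = τ ^ 2 * r ∧ r ∣ X ∧
      (3 * A - c = τ ^ 2 ∨ 3 * A - c = -τ ^ 2) := by
    rcases hτ with ⟨-, rfl⟩ | ⟨rfl, rfl⟩
    · refine ⟨A - 3 * c, by ring, ?_, ?_⟩
      · rw [one_pow, one_mul] at h4
        rwa [show A - 3 * c = (A - c) * 1 - 2 * c * 1 by ring]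
      · rw [one_pow] at h5
        have := Int.isUnit_iff.mp (isUnit_of_dvd_one h5)
        omega
    · push_cast at *
      obtain ⟨l, rfl⟩ := Nat.exists_eq_add_of_le' hh
      rw [pow_succ] at hN
      -- `A - 3c` and `3A - c` are `4` times odd numbers, and `h5` says `3A - c ∣ 2 ^ (2 * k)`
      have hco : ∀ w : ℤ, Odd w → IsCoprime w ((2 : ℤ) ^ (2 * k)) := fun w hw =>
        ((Prime.coprime_iff_not_dvd Int.prime_two).mpr (by
          have := Int.not_even_iff_odd.mpr hw
          rwa [even_iff_two_dvd] at this)).symm.pow_right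
      have hcodd : Odd c := Int.not_even_iff_odd.mp fun h => hpc h.two_dvd
      have hr : Odd (2 * 2 ^ l - c) := by
        rw [Int.odd_sub']; simp [hcodd]
      have hw : Odd (3 * (2 * 2 ^ l) - c) := by
        rw [Int.odd_sub']; simp [hcodd]
      refine ⟨2 * 2 ^ l - c, by linarith, ?_, ?_⟩
      · refine (hco _ hr).dvd_of_dvd_mul_left (dvd_trans ⟨4, ?_⟩ h4)
        linarith
      · have h6 : 3 * (2 * 2 ^ l) - c ∣ 2 ^ (2 * k) := dvd_trans ⟨4, by linarith⟩ h5
        have := Int.isUnit_iff.mp ((hco _ hw).isUnit_of_dvd' dvd_rfl h6)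
        omega
  refine ⟨r, hr, hI1, hrX, ?_⟩
  have hI2 : (3 * A - c) ^ 2 = τ ^ 4 := by
    rcases hI1 with h | h <;> rw [h] <;> ring
  have h6 : τ ^ 4 * (A * r ^ 2 + c) = τ ^ 4 * (τ ^ 2 * (p : ℤ) ^ (3 * h)) := by
    rw [show τ ^ 4 * (τ ^ 2 * (p : ℤ) ^ (3 * h)) = (τ ^ 2 * (p : ℤ) ^ h) ^ 3 by ring, ← hN]
    linear_combination -A * (A - 3 * c + τ ^ 2 * r) * hr - c * hI2
  exact mul_left_cancel₀ (by positivity) h6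

/-- Two solutions with positive second entries of the same parity occur only in four cases. -/
theorem same_parity_classification {p b c y d x₁ x₂ : ℕ} (hp : p.Prime) (hb : 1 < b) (hc : 1 < c)
    (hpb : ¬ p ∣ b) (hy : 0 < y) (hd : 0 < d) (h₁ : p ^ x₁ = b ^ y + c)
    (h₂ : p ^ x₂ = b ^ (y + 2 * d) + c) :
    y = 1 ∧ (p = 2 ∧ b = 5 ∧ c = 3 ∧ d = 1 ∨ p = 13 ∧ b = 3 ∧ c = 10 ∧ d = 3 ∨
      p = 2 ∧ b = 3 ∧ c = 13 ∧ d = 2 ∨ p = 2 ∧ b = 3 ∧ c = 5 ∧ d = 1) := by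
  have hx₁ : x₁ ≠ 0 := by
    rintro rfl
    have : 0 < b ^ y := by positivity
    rw [pow_zero] at h₁
    omega
  have hqc : ∀ q : ℕ, q.Prime → q ∣ b → ¬ q ∣ c := by
    intro q hq hqb hqc
    have h1 : q ∣ p ^ x₁ := h₁ ▸ dvd_add (hqb.trans (dvd_pow_self b hy.ne')) hqc
    exact hpb ((Nat.prime_dvd_prime_iff_eq hq hp).mp (hq.dvd_of_dvd_pow h1) ▸ hqb)
  have hpc : ¬ p ∣ c := fun h =>
    hpb (hp.dvd_of_dvd_pow ((Nat.dvd_add_left h).mp (h₁ ▸ dvd_pow_self p hx₁)))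
  have hmono : b ^ y < b ^ (y + 2 * d) := Nat.pow_lt_pow_right hb (by omega)
  obtain ⟨τ, h, m, hτ, hh, e₁, e₂⟩ : ∃ τ : ℤ, ∃ h m : ℕ, (p ≠ 2 ∧ τ = 1 ∨ p = 2 ∧ τ = 2) ∧ 0 < h ∧
      ((b ^ y : ℕ) : ℤ) + (c : ℤ) = τ ^ 2 * (p : ℤ) ^ h ∧
      ((b ^ y : ℕ) : ℤ) * ((b ^ d : ℕ) : ℤ) ^ 2 + (c : ℤ) = τ ^ 2 * (p : ℤ) ^ m := by
    have h₁' : (p : ℤ) ^ x₁ = (b : ℤ) ^ y + c := by exact_mod_cast h₁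
    have h₂' : (p : ℤ) ^ x₂ = (b : ℤ) ^ (y + 2 * d) + c := by exact_mod_cast h₂
    by_cases h2 : p = 2
    · have h3 : 3 ≤ b ^ y := by
        have : 3 ≤ b := by
          rcases Nat.lt_or_ge b 3 with h | h
          · have : b = 2 := by omega
            exact absurd (h2 ▸ this ▸ dvd_rfl) hpb
          · exact h
        exact this.trans (Nat.le_self_pow hy.ne' b)
      have h4 : 3 ≤ c := by
        rcases Nat.lt_or_ge c 3 with h | h
        · have : c = 2 := by omega
          exact absurd (h2 ▸ this ▸ dvd_rfl) hpc
        · exact h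
      subst h2
      have h5 : ∀ x, 6 ≤ 2 ^ x → 3 ≤ x := fun x hx => by
        by_contra hlt
        have : 2 ^ x ≤ 2 ^ 2 := Nat.pow_le_pow_right (by norm_num) (by omega)
        omega
      obtain ⟨h, rfl⟩ := Nat.exists_eq_add_of_le' (h5 x₁ (by omega))
      obtain ⟨m, rfl⟩ := Nat.exists_eq_add_of_le' (h5 x₂ (by omega))
      refine ⟨2, h + 1, m + 1, Or.inr ⟨rfl, rfl⟩, by omega, ?_, ?_⟩
      · push_cast
        push_cast at h₁'
        rw [← h₁']
        ring
      · push_cast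
        push_cast at h₂'
        linear_combination -h₂'
    · refine ⟨1, x₁, x₂, Or.inl ⟨h2, rfl⟩, by omega, ?_, ?_⟩
      · push_cast
        rw [h₁']; ring
      · push_cast
        rw [h₂']; ring
  have hpA : ¬ (p : ℤ) ∣ ((b ^ y : ℕ) : ℤ) := by
    intro h; exact hpb (hp.dvd_of_dvd_pow (by exact_mod_cast h))
  have hpX : ¬ (p : ℤ) ∣ ((b ^ d : ℕ) : ℤ) := by
    intro h; exact hpb (hp.dvd_of_dvd_pow (by exact_mod_cast h))
  have hpc' : ¬ (p : ℤ) ∣ (c : ℤ) := by exact_mod_cast hpc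
  have hA0 : (0 : ℤ) < ((b ^ y : ℕ) : ℤ) := by exact_mod_cast (by positivity : 0 < b ^ y)
  have hc' : (1 : ℤ) < (c : ℤ) := by exact_mod_cast hc
  have hX1 : 1 < b ^ d := Nat.one_lt_pow hd.ne' hb
  by_cases h9 : 3 ∣ b → 9 ∣ b ^ y
  · obtain ⟨h3, h4⟩ := small_of_prime_factors_dvd (X := b ^ d) hp hτ hh hA0 hc' hpA hpc' e₁ hX1
      (fun q hq hqX => by
        have hqb := hq.dvd_of_dvd_pow hqX
        refine ⟨by exact_mod_cast hqb.trans (dvd_pow_self b hy.ne'),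
          by exact_mod_cast hqc q hq hqb, ?_⟩
        rintro rfl
        exact_mod_cast h9 hqb) e₂
    have hp2 : p = 2 := by
      have := (Nat.prime_dvd_prime_iff_eq hp Nat.prime_two).mp (h3 ▸ dvd_pow_self p hh.ne')
      exact this
    subst hp2
    obtain rfl : τ = 2 := by omega
    have h5 : b ^ y + c = 8 := by
      have h6 : ((2 : ℕ) : ℤ) ^ h = 2 := by exact_mod_cast h3
      rw [h6] at e₁
      have : ((b ^ y + c : ℕ) : ℤ) = 8 := by push_cast at e₁ ⊢; rw [e₁]
      exact_mod_cast this
    have hb' : ∀ q : ℕ, q.Prime → b ^ d ∣ q → b = q ∧ d = 1 := by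
      intro q hq hdvd
      have h6 : b ^ d = q := ((Nat.dvd_prime hq).mp hdvd).resolve_left hX1.ne'
      have h7 : d = 1 := (Nat.Prime.eq_one_of_pow (h6 ▸ hq : (b ^ d).Prime))
      subst h7
      exact ⟨by simpa using h6, rfl⟩
    rcases h4 with h4 | h4
    · obtain ⟨rfl, rfl⟩ := hb' 3 Nat.prime_three h4
      have := Nat.le_of_dvd (by positivity) (h9 dvd_rfl)
      omega
    · obtain ⟨rfl, rfl⟩ := hb' 5 Nat.prime_five h4
      have hy1 : y = 1 := by
        by_contra hne
        have : 5 ^ 2 ≤ 5 ^ y := Nat.pow_le_pow_right (by norm_num) (by omega)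
        omega
      subst hy1
      exact ⟨rfl, Or.inl ⟨rfl, rfl, by omega, rfl⟩⟩
  · have h3b : 3 ∣ b := by by_contra h; exact h9 fun h' => absurd h' h
    have h9' : ¬ 9 ∣ b ^ y := fun h => h9 fun _ => h
    have hy1 : y = 1 := by
      by_contra hne
      refine h9' ((pow_dvd_pow_of_dvd h3b 2).trans (pow_dvd_pow b (by omega)))
    subst hy1
    refine ⟨rfl, ?_⟩
    rw [pow_one] at *
    have h3c : ¬ (3 : ℤ) ∣ (c : ℤ) := by exact_mod_cast hqc 3 Nat.prime_three h3b
    obtain ⟨r, hr, hI, hrX, e₃⟩ := exists_cube_of_three_dvd hp hτ hh hA0 hc' hpA hpc' e₁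
      (by exact_mod_cast h3b) h3c
      (by exact_mod_cast h3b.trans (dvd_pow_self b hd.ne')) hpX e₂
    have h3r : (3 : ℤ) ∣ r := by
      have h4 : (3 : ℤ) ∣ τ ^ 2 * r := by
        rw [← hr]
        exact dvd_sub (by exact_mod_cast h3b) (dvd_mul_right _ _)
      refine (Int.prime_three.dvd_or_dvd h4).resolve_left fun h5 => ?_
      have := Int.prime_three.dvd_of_dvd_pow h5
      omega
    have hr0 : r ≠ 0 := by
      rintro rfl
      rw [zero_dvd_iff] at hrX
      have : b ^ d = 0 := by exact_mod_cast hrX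
      omega
    obtain ⟨z, hz⟩ := hrX
    have hpr : ¬ (p : ℤ) ∣ (b : ℤ) * r ^ 2 := by
      have hpi := Nat.prime_iff_prime_int.mp hp
      intro h4
      rcases hpi.dvd_or_dvd h4 with h5 | h5
      · exact hpA h5
      · exact hpX (hz ▸ (hpi.dvd_of_dvd_pow h5).mul_right z)
    -- `r√A ± √(-c)` has norm at least `2 ^ 3`, so it can be followed by no further power
    have hz1 : ¬ 1 < z.natAbs := by
      intro hlt
      have h4 := (small_of_prime_factors_dvd (A := b * r ^ 2) (h := 3 * h) (X := z.natAbs) (m := m)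
        hp hτ (by omega) (by positivity) hc' hpr hpc' e₃ hlt (fun q hq hqz => by
          have hqb : q ∣ b := by
            refine hq.dvd_of_dvd_pow (n := d) ?_
            have : (q : ℤ) ∣ ((b ^ d : ℕ) : ℤ) := by
              rw [hz]; exact (Int.natCast_dvd.mpr hqz).mul_left r
            exact_mod_cast this
          refine ⟨Dvd.dvd.mul_right (by exact_mod_cast hqb) _, by exact_mod_cast hqc q hq hqb, ?_⟩
          intro _
          exact Dvd.dvd.mul_left (pow_dvd_pow_of_dvd h3r 2) _) (by
            rw [← e₂, hz, Int.natCast_natAbs, sq_abs]; ring)).1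
      have h5 : 2 ^ 3 ≤ p ^ (3 * h) :=
        (Nat.pow_le_pow_left hp.two_le 3).trans (Nat.pow_le_pow_right hp.pos (by omega))
      omega
    have hz0 : z ≠ 0 := by
      rintro rfl
      rw [mul_zero] at hz
      have : b ^ d = 0 := by exact_mod_cast hz
      omega
    have hbr : ((b ^ d : ℕ) : ℤ) = r ∨ ((b ^ d : ℕ) : ℤ) = -r := by
      have : z = 1 ∨ z = -1 := by omega
      rcases this with rfl | rfl
      · left; linarith
      · right; linarith
    have hbdvd : (b : ℤ) ∣ r := by
      have h4 : (b : ℤ) ∣ ((b ^ d : ℕ) : ℤ) := by exact_mod_cast dvd_pow_self b hd.ne'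
      rcases hbr with h5 | h5
      · rwa [h5] at h4
      · rwa [h5, dvd_neg] at h4
    have hb3 : b = 3 := by
      have h4 : (b : ℤ) ∣ c * 3 := by
        have : (c : ℤ) * 3 = b - τ ^ 2 * r := by linarith
        rw [this]
        exact dvd_sub dvd_rfl (hbdvd.mul_left _)
      have h5 : b ∣ c * 3 := by exact_mod_cast h4
      have h6 : b.Coprime c := Nat.coprime_of_dvd fun q hq hqb => hqc q hq hqb
      exact ((Nat.dvd_prime Nat.prime_three).mp (h6.dvd_of_dvd_mul_left h5)).resolve_left hb.ne'
    subst hb3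
    have hinj : ∀ n, 3 ^ d = 3 ^ n → d = n := fun n hn =>
      Nat.pow_right_injective (by norm_num) hn
    have hbr' : 3 ^ d = r.natAbs := by
      rcases hbr with h4 | h4 <;> omega
    rcases hτ with ⟨hp2, rfl⟩ | ⟨rfl, rfl⟩
    · rcases hI with hI | hI
      · have : r.natAbs = 21 := by push_cast at *; omega
        rw [this] at hbr'
        have h7 : 7 ∣ 3 ^ d := hbr' ▸ by norm_num
        have := (by norm_num : Nat.Prime 7).dvd_of_dvd_pow h7
        omega
      · have hc10 : c = 10 := by push_cast at *; omega
        subst hc10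
        have : r.natAbs = 3 ^ 3 := by push_cast at *; omega
        have hp13 : p ^ h = 13 := by
          have : ((p ^ h : ℕ) : ℤ) = 13 := by push_cast at *; linarith
          exact_mod_cast this
        have := (Nat.prime_dvd_prime_iff_eq hp (by norm_num : Nat.Prime 13)).mp
          (hp13 ▸ dvd_pow_self p hh.ne')
        exact Or.inr (Or.inl ⟨this, rfl, rfl, hinj 3 (by omega)⟩)
    · rcases hI with hI | hI
      · have hc5 : c = 5 := by push_cast at *; omega
        subst hc5
        have : r.natAbs = 3 ^ 1 := by push_cast at *; omega
        exact Or.inr (Or.inr (Or.inr ⟨rfl, rfl, rfl, hinj 1 (by omega)⟩))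
      · have hc13 : c = 13 := by push_cast at *; omega
        subst hc13
        have : r.natAbs = 3 ^ 2 := by push_cast at *; omega
        exact Or.inr (Or.inr (Or.inl ⟨rfl, rfl, rfl, hinj 2 (by omega)⟩))

/-! ### Solutions with `c = 1` or `p ∣ b` -/

/-- If `p ∣ b`, two solutions would give
`p ^ x₁ ∣ p ^ x₂ - p ^ x₁ = b ^ y₁ (b ^ (y₂ - y₁) - 1)`, so `p ^ x₁ ∣ b ^ y₁ < p ^ x₁`. -/
lemma false_of_dvd_base {p b c x₁ x₂ y₁ y₂ : ℕ} (hp : p.Prime) (hb : 1 < b) (hc : 0 < c)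
    (hpb : p ∣ b) (hy : y₁ < y₂) (h₁ : p ^ x₁ = b ^ y₁ + c) (h₂ : p ^ x₂ = b ^ y₂ + c) : False := by
  obtain ⟨d, rfl⟩ := Nat.exists_eq_add_of_lt hy
  have hmono : b ^ y₁ < b ^ (y₁ + d + 1) := Nat.pow_lt_pow_right hb hy
  have hx : x₁ < x₂ := (Nat.pow_lt_pow_iff_right hp.one_lt).mp (by omega)
  have h1 : (p : ℤ) ^ x₁ ∣ (b : ℤ) ^ y₁ * ((b : ℤ) ^ (d + 1) - 1) := by
    have e : (b : ℤ) ^ y₁ * ((b : ℤ) ^ (d + 1) - 1) = (p : ℤ) ^ x₂ - (p : ℤ) ^ x₁ := by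
      have h₁' : (p : ℤ) ^ x₁ = (b : ℤ) ^ y₁ + c := by exact_mod_cast h₁
      have h₂' : (p : ℤ) ^ x₂ = (b : ℤ) ^ (y₁ + d + 1) + c := by exact_mod_cast h₂
      rw [h₁', h₂']; ring
    rw [e]
    exact dvd_sub (pow_dvd_pow _ hx.le) dvd_rfl
  have hpi : Prime (p : ℤ) := Nat.prime_iff_prime_int.mp hp
  have h2 : ¬ (p : ℤ) ∣ (b : ℤ) ^ (d + 1) - 1 := by
    intro h
    have h3 : (p : ℤ) ∣ (b : ℤ) ^ (d + 1) :=
      dvd_pow (by exact_mod_cast hpb) (by omega)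
    exact hpi.not_dvd_one ((dvd_sub_right h3).mp h)
  have h3 : p ^ x₁ ∣ b ^ y₁ := by
    have := (((Prime.coprime_iff_not_dvd hpi).mpr h2).pow_left).dvd_of_dvd_mul_right h1
    exact_mod_cast this
  have := Nat.le_of_dvd (by positivity) h3
  omega

lemma eq_of_pow_add_one_eq {a p : ℕ} (ha : 2 ≤ a) (hp : 3 ≤ p) (h : a ^ p + 1 = p * (a + 1)) :
    a = 2 ∧ p = 3 := by
  obtain ⟨n, rfl⟩ := Nat.exists_eq_add_of_le' hp
  have ha2 : a = 2 := by
    by_contra hne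
    have h2 : 2 * (n + 3) ≤ 3 ^ (n + 2) := by
      clear * -
      induction n with
      | zero => norm_num
      | succ n ih => rw [show n + 1 + 2 = n + 2 + 1 by ring, pow_succ]; omega
    have h3 : 3 ^ (n + 2) ≤ a ^ (n + 2) := Nat.pow_le_pow_left (by omega) _
    have h4 : a ^ (n + 3) = a ^ (n + 2) * a := pow_succ _ _
    nlinarith
  subst ha2
  refine ⟨rfl, ?_⟩
  by_contra hne
  obtain ⟨k, rfl⟩ := Nat.exists_eq_add_of_le' (show 1 ≤ n by omega)
  have h5 : 3 * k + 12 < 2 ^ (k + 4) := by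
    clear * -
    induction k with
    | zero => norm_num
    | succ n ih => rw [show n + 1 + 4 = n + 4 + 1 by ring, pow_succ]; omega
  rw [show k + 1 + 3 = k + 4 by ring] at h
  omega

lemma eq_three_of_three_pow_eq {x y : ℕ} (hy : 1 < y) (h : 3 ^ x = 2 ^ y + 1) : y = 3 := by
  by_contra hne
  rcases Nat.lt_or_ge y 4 with h4 | h4
  · obtain rfl : y = 2 := by omega
    have h3 : 3 ∣ 3 ^ x := dvd_pow_self 3 (by rintro rfl; norm_num at h)
    rw [h] at h3
    norm_num at h3
  · obtain ⟨k, rfl⟩ := Nat.exists_eq_add_of_le' h4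
    -- `3 ^ x ≡ 1 (mod 16)` forces `4 ∣ x`, hence `5 ∣ 3 ^ x - 1`, a power of `2`
    have h16 : 3 ^ x % 16 = 1 := by rw [h, pow_add]; omega
    rw [← Nat.div_add_mod x 4, pow_add, pow_mul] at h16 h
    have h81 : (3 ^ 4) ^ (x / 4) % 16 = 1 := by rw [Nat.pow_mod]; norm_num
    have h81' : (3 ^ 4) ^ (x / 4) % 5 = 1 := by rw [Nat.pow_mod]; norm_num
    have hlt : x % 4 < 4 := Nat.mod_lt _ (by norm_num)
    have hx : x % 4 = 0 := by
      rw [Nat.mul_mod, h81] at h16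
      interval_cases x % 4 <;> simp_all
    rw [hx, pow_zero, mul_one] at h
    have h5 : 5 ∣ 2 ^ (k + 4) := by omega
    have := (Nat.prime_five).dvd_of_dvd_pow h5
    omega

/-- The case `c = 1`: `b ^ y₁ + 1 ∣ b ^ y₂ + 1` makes `y₂` an odd multiple of `y₁`, and then
`(b ^ y₁) ^ p + 1` is a power of `p`, which lifting the exponent determines. -/
lemma eq_of_pow_eq_pow_add_one {p b x₁ x₂ y₁ y₂ : ℕ} (hp : p.Prime) (hb : 1 < b) (hy₁ : 0 < y₁)
    (hy : y₁ < y₂) (h₁ : p ^ x₁ = b ^ y₁ + 1) (h₂ : p ^ x₂ = b ^ y₂ + 1) :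
    p = 3 ∧ b = 2 ∧ y₁ = 1 ∧ y₂ = 3 := by
  have hpi : Prime (p : ℤ) := Nat.prime_iff_prime_int.mp hp
  have hmono : b ^ y₁ < b ^ y₂ := Nat.pow_lt_pow_right hb hy
  have hx : x₁ < x₂ := (Nat.pow_lt_pow_iff_right hp.one_lt).mp (by omega)
  have ha : 2 ≤ b ^ y₁ := hb.trans_le (Nat.le_self_pow hy₁.ne' b)
  have hx₁ : x₁ ≠ 0 := by rintro rfl; rw [pow_zero] at h₁; omega
  obtain ⟨a, haa⟩ : ∃ a, a = b ^ y₁ := ⟨_, rfl⟩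
  obtain ⟨q, r, hr, hqr⟩ : ∃ q r, r < y₁ ∧ y₂ = y₁ * q + r :=
    ⟨y₂ / y₁, y₂ % y₁, Nat.mod_lt _ hy₁, (Nat.div_add_mod _ _).symm⟩
  have hbr : b ^ r < a := haa ▸ Nat.pow_lt_pow_right hb hr
  have hN : (p : ℤ) ^ x₁ = a + 1 := by rw [haa]; exact_mod_cast h₁
  have h₂' : (p : ℤ) ^ x₂ = (a : ℤ) ^ q * (b : ℤ) ^ r + 1 := by
    have : p ^ x₂ = a ^ q * b ^ r + 1 := by rw [h₂, hqr, pow_add, pow_mul, haa]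
    exact_mod_cast this
  have hdvd : (a : ℤ) + 1 ∣ (a : ℤ) ^ q * (b : ℤ) ^ r + 1 := by
    rw [← hN, ← h₂']; exact pow_dvd_pow _ hx.le
  have hgeom : (a : ℤ) + 1 ∣ (a : ℤ) ^ q - (-1) ^ q := by
    simpa using sub_dvd_pow_sub_pow (a : ℤ) (-1) q
  have hdvd2 : (a : ℤ) + 1 ∣ (-1) ^ q * (b : ℤ) ^ r + 1 := by
    have := dvd_sub hdvd (hgeom.mul_right ((b : ℤ) ^ r))
    rwa [show (a : ℤ) ^ q * (b : ℤ) ^ r + 1 - ((a : ℤ) ^ q - (-1) ^ q) * (b : ℤ) ^ r =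
      (-1) ^ q * (b : ℤ) ^ r + 1 by ring] at this
  have hbr' : (b : ℤ) ^ r < a := by exact_mod_cast hbr
  have hbr0 : (0 : ℤ) < (b : ℤ) ^ r := by positivity
  have hq : Odd q := by
    by_contra hq
    rw [(Nat.not_odd_iff_even.mp hq).neg_one_pow, one_mul] at hdvd2
    have := Int.le_of_dvd (by omega) hdvd2
    omega
  rw [hq.neg_one_pow] at hdvd2
  have hbr1 : (b : ℤ) ^ r = 1 := by
    have := Int.eq_zero_of_abs_lt_dvd hdvd2 (by rw [abs_lt]; constructor <;> omega)
    omega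
  rw [hbr1, mul_one] at h₂'
  have hpa1 : (p : ℤ) ∣ (a : ℤ) - (-1) := by
    rw [sub_neg_eq_add, ← hN]; exact dvd_pow_self _ hx₁
  -- the cofactor of `a + 1` in `a ^ q + 1` is a nontrivial power of `p` and is `≡ q (mod p)`
  have hpq : p ∣ q := by
    have h3 := Commute.geom_sum₂_mul (Commute.all (a : ℤ) (-1)) q
    rw [hq.neg_one_pow, sub_neg_eq_add, sub_neg_eq_add, ← hN, ← h₂'] at h3
    obtain ⟨j, rfl⟩ := Nat.exists_eq_add_of_lt hx
    rw [show x₁ + j + 1 = (j + 1) + x₁ by ring, pow_add (p : ℤ) (j + 1)] at h3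
    have h4 := mul_right_cancel₀ (pow_ne_zero _ hpi.ne_zero) h3
    have h5 : (p : ℤ) ∣ q * (-1) ^ (q - 1) :=
      (dvd_geom_sum₂_iff_of_dvd_sub hpa1).mp (h4 ▸ dvd_pow_self _ (by omega))
    have h6 : (p : ℤ) ∣ q := by
      rcases neg_one_pow_eq_or ℤ (q - 1) with h | h <;> rw [h] at h5 <;> simpa using h5
    exact_mod_cast h6
  obtain ⟨l, rfl⟩ := hpq
  have hpo : Odd p := (Nat.odd_mul.mp hq).1
  have hp3 : 3 ≤ p := by
    have := hp.two_le
    rcases hpo with ⟨j, rfl⟩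
    omega
  have hpa : ¬ (p : ℤ) ∣ (a : ℤ) := fun h =>
    hpi.not_dvd_one ((dvd_add_right h).mp (by simpa using hpa1))
  obtain ⟨g, -, hg⟩ : ∃ g ≤ x₂, a ^ p + 1 = p ^ g := by
    refine (Nat.dvd_prime_pow hp).mp ?_
    have h3 : (a : ℤ) ^ p + 1 ∣ ((a : ℤ) ^ p) ^ l + 1 ^ l :=
      Odd.add_dvd_pow_add_pow _ _ (Nat.odd_mul.mp hq).2
    rw [← pow_mul, one_pow, ← h₂'] at h3
    exact_mod_cast h3
  have hg1 : g = x₁ + 1 := by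
    have h3 := Int.emultiplicity_pow_add_pow hp hpo (x := (a : ℤ)) (y := 1) (by simpa using hpa1)
      hpa hpo
    rw [one_pow, show (a : ℤ) ^ p + 1 = (p : ℤ) ^ g by exact_mod_cast hg, ← hN] at h3
    rw [emultiplicity_pow_self_of_prime hpi, emultiplicity_pow_self_of_prime hpi] at h3
    have h4 : emultiplicity p p = 1 := by
      have := emultiplicity_pow_self_of_prime (Nat.prime_iff.mp hp) 1
      simpa using this
    rw [h4] at h3
    exact_mod_cast h3
  have hN' : p ^ x₁ = a + 1 := haa ▸ h₁
  rw [hg1, pow_succ, hN', mul_comm] at hg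
  obtain ⟨ha2, rfl⟩ := eq_of_pow_add_one_eq (haa ▸ ha) hp3 hg
  have hby : b ^ y₁ = 2 := by rw [← haa, ha2]
  have hy1 : y₁ = 1 := by
    have : (b ^ y₁).Prime := hby ▸ Nat.prime_two
    exact this.eq_one_of_pow
  subst hy1
  rw [pow_one] at hby
  subst hby
  exact ⟨rfl, rfl, rfl, eq_three_of_three_pow_eq hy h₂⟩

/-! ### Solutions with `y = 0`, `y` even and `y` odd -/

/-- An element of `ℤ√d` whose imaginary part has `2`-adic valuation exactly `f` and whose real part
is `1` modulo a higher power of `2`. -/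
def NearOne {d : ℤ} (f : ℕ) (x : ℤ√d) : Prop :=
  (2 : ℤ) ^ (f + 1) ∣ x.re - 1 ∧ ∃ v : ℤ, Odd v ∧ x.im = 2 ^ f * v

lemma NearOne.odd_re {d : ℤ} {f : ℕ} {x : ℤ√d} (hx : NearOne f x) : Odd x.re := by
  obtain ⟨w, hw⟩ := hx.1
  exact ⟨2 ^ f * w, by rw [pow_succ] at hw; linarith⟩

lemma NearOne.sq {d : ℤ} (hd : Even d) {f : ℕ} (hf : 0 < f) {x : ℤ√d} (hx : NearOne f x) :
    NearOne (f + 1) (x ^ 2) := by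
  have hodd := hx.odd_re
  obtain ⟨u, hu⟩ := hodd
  obtain ⟨⟨w, hw⟩, v, hv, hv'⟩ := hx
  obtain ⟨e, rfl⟩ := even_iff_two_dvd.mp hd
  obtain ⟨g, rfl⟩ := Nat.exists_eq_add_of_le' hf
  refine ⟨?_, x.re * v, Int.odd_mul.mpr ⟨⟨u, hu⟩, hv⟩, ?_⟩
  · rw [pow_two, Zsqrtd.re_mul, hv']
    refine ⟨w * (u + 1) + e * 2 ^ g * v * v, ?_⟩
    have : x.re * x.re - 1 = 2 ^ (g + 1 + 1) * w * (2 * u + 2) := by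
      rw [← hw, hu]; ring
    linear_combination this
  · rw [pow_two, Zsqrtd.im_mul, hv']
    ring

lemma NearOne.mul {d : ℤ} {f g : ℕ} (hfg : f < g) {x y : ℤ√d} (hx : NearOne g x)
    (hy : NearOne f y) : NearOne f (x * y) := by
  have hodd := hx.odd_re
  obtain ⟨⟨w, hw⟩, v, -, hv'⟩ := hx
  obtain ⟨⟨w', hw'⟩, v', hv2, hv2'⟩ := hy
  obtain ⟨j, rfl⟩ := Nat.exists_eq_add_of_lt hfg
  refine ⟨?_, x.re * v' + 2 * (2 ^ j * v * y.re), (hodd.mul hv2).add_even (even_two_mul _), ?_⟩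
  · rw [Zsqrtd.re_mul, hv', hv2']
    refine ⟨2 ^ (j + 1) * w * y.re + w' + d * 2 ^ j * v * (2 ^ f * v'), ?_⟩
    linear_combination y.re * hw + hw'
  · rw [Zsqrtd.im_mul, hv', hv2']
    ring

lemma NearOne.pow {d : ℤ} (hd : Even d) {f : ℕ} (hf : 0 < f) {x : ℤ√d} (hx : NearOne f x) (k : ℕ) :
    0 < k → ∃ g, f ≤ g ∧ NearOne g (x ^ k) := by
  induction k using Nat.strong_induction_on with
  | _ k ih =>
  intro hk
  obtain ⟨j, rfl | rfl⟩ := Nat.even_or_odd' k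
  · obtain ⟨g, hfg, hg⟩ := ih j (by omega) (by omega)
    refine ⟨g + 1, by omega, ?_⟩
    rw [mul_comm, pow_mul]
    exact hg.sq hd (by omega)
  · rcases Nat.eq_zero_or_pos j with rfl | hj
    · exact ⟨f, le_rfl, by simpa using hx⟩
    · obtain ⟨g, hfg, hg⟩ := ih j (by omega) hj
      refine ⟨f, le_rfl, ?_⟩
      rw [pow_succ, mul_comm 2 j, pow_mul]
      exact (hg.sq hd (by omega)).mul (by omega) hx

lemma NearOne.re_add_im_ne_one {d : ℤ} {f : ℕ} {x : ℤ√d} (hx : NearOne f x) :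
    x.re + x.im ≠ 1 := by
  obtain ⟨⟨w, hw⟩, v, hv, hv'⟩ := hx
  intro h
  have h1 : (2 : ℤ) ^ f * v = 2 ^ f * (2 * -w) := by rw [pow_succ] at hw; linarith
  rw [mul_left_cancel₀ (by positivity) h1] at hv
  exact Int.not_odd_iff_even.mpr (even_two_mul _) hv

lemma oddPow_one_eq_zsqrtd (c : ℤ) (k : ℕ) :
    (oddPow 1 c k).2 = ((⟨1 - c, 2⟩ : ℤ√(-c)) ^ k).re + ((⟨1 - c, 2⟩ : ℤ√(-c)) ^ k).im ∧
    (oddPow 1 c k).1 = ((⟨1 - c, 2⟩ : ℤ√(-c)) ^ k).re - c * ((⟨1 - c, 2⟩ : ℤ√(-c)) ^ k).im := by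
  induction k with
  | zero => simp [oddPow]
  | succ k ih =>
    obtain ⟨h1, h2⟩ := ih
    simp only [oddPow, pow_succ, Zsqrtd.re_mul, Zsqrtd.im_mul, h1, h2]
    constructor <;> ring

/-- The imaginary part of `(1 + √(-c)) ^ (2 * k + 1)` does not return to the value `1`: `2`-adically
it is `1 + 2 ^ g * v` with `v` odd. -/
lemma oddPow_one_snd_ne_one {c : ℤ} {k : ℕ} (hk : 0 < k) (hc : c % 4 = 0 ∨ c % 4 = 2 ∧ Even k) :
    (oddPow 1 c k).2 ≠ 1 := by
  rw [(oddPow_one_eq_zsqrtd c k).1]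
  have hd : Even (-c) := by rw [Int.even_iff]; omega
  rcases hc with hc | ⟨hc, hk2⟩
  · have h1 : NearOne 1 (⟨1 - c, 2⟩ : ℤ√(-c)) := by
      refine ⟨?_, 1, odd_one, by norm_num⟩
      norm_num
      omega
    obtain ⟨g, -, hg⟩ := h1.pow hd one_pos k hk
    exact hg.re_add_im_ne_one
  · have h1 : NearOne 2 ((⟨1 - c, 2⟩ : ℤ√(-c)) ^ 2) := by
      obtain ⟨e, rfl⟩ : ∃ e, c = 4 * e + 2 := ⟨c / 4, by omega⟩
      refine ⟨?_, 1 - (4 * e + 2), ⟨-2 * e - 1, by ring⟩, ?_⟩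
      · rw [pow_two, Zsqrtd.re_mul]
        exact ⟨2 * e ^ 2 - e - 1, by ring⟩
      · rw [pow_two, Zsqrtd.im_mul]
        ring
    obtain ⟨j, rfl⟩ := even_iff_two_dvd.mp hk2
    obtain ⟨g, -, hg⟩ := h1.pow hd two_pos j (by omega)
    rw [pow_mul]
    exact hg.re_add_im_ne_one

lemma oddPow_one_dvd_sub (c : ℤ) (k : ℕ) : 1 + c ∣ (oddPow 1 c k).1 - (oddPow 1 c k).2 := by
  cases k with
  | zero => simp [oddPow]
  | succ k =>
    refine ⟨-((oddPow 1 c k).1 + (oddPow 1 c k).2), ?_⟩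
    simp only [oddPow]
    ring

lemma oddPow_one_mod_four_of_zero {c : ℤ} (hc : c % 4 = 0) (k : ℕ) : (oddPow 1 c k).1 % 4 = 1 := by
  obtain ⟨e, rfl⟩ : ∃ e, c = 4 * e := ⟨c / 4, by omega⟩
  induction k with
  | zero => simp [oddPow]
  | succ k ih =>
    have : (oddPow 1 (4 * e) (k + 1)).1 = (oddPow 1 (4 * e) k).1 +
        4 * (-e * (oddPow 1 (4 * e) k).1 - 2 * e * (oddPow 1 (4 * e) k).2) := by
      simp only [oddPow]; ring
    omega

lemma oddPow_one_mod_four_of_two {c : ℤ} (hc : c % 4 = 2) (k : ℕ) :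
    (oddPow 1 c k).2 % 4 = 1 ∧ (oddPow 1 c k).1 % 4 = if Even k then 1 else 3 := by
  obtain ⟨e, rfl⟩ : ∃ e, c = 4 * e + 2 := ⟨c / 4, by omega⟩
  induction k with
  | zero => simp [oddPow]
  | succ k ih =>
    have h1 : (oddPow 1 (4 * e + 2) (k + 1)).1 = -(oddPow 1 (4 * e + 2) k).1 +
        4 * (-e * (oddPow 1 (4 * e + 2) k).1 - (2 * e + 1) * (oddPow 1 (4 * e + 2) k).2) := by
      simp only [oddPow]; ring
    have h2 : (oddPow 1 (4 * e + 2) (k + 1)).2 = -(oddPow 1 (4 * e + 2) k).2 +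
        2 * (oddPow 1 (4 * e + 2) k).1 + 4 * (-e * (oddPow 1 (4 * e + 2) k).2) := by
      simp only [oddPow]; ring
    by_cases hk : Even k
    · simp only [hk, if_true, Nat.even_add_one, not_true, if_false] at ih ⊢
      omega
    · simp only [hk, if_false, Nat.even_add_one, not_false_iff, if_true] at ih ⊢
      omega

lemma Nat.pow_mod_four_of_three_of_odd {n k : ℕ} (hn : n % 4 = 3) (hk : Odd k) :
    n ^ k % 4 = 3 := by
  obtain ⟨j, rfl⟩ := hk
  rw [pow_succ, pow_mul, Nat.mul_mod, Nat.pow_mod, Nat.pow_mod n 2, hn]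
  norm_num

lemma Nat.pow_mod_four_of_three_of_even {n k : ℕ} (hn : n % 4 = 3) (hk : Even k) :
    n ^ k % 4 = 1 := by
  obtain ⟨j, rfl⟩ := even_iff_two_dvd.mp hk
  rw [pow_mul, Nat.pow_mod, Nat.pow_mod n 2, hn]
  norm_num

lemma Nat.mod_four_of_pow_mod_four {n k : ℕ} (h : n ^ k % 4 = 3) : n % 4 = 3 ∧ Odd k := by
  have h0 : k ≠ 0 := by rintro rfl; simp at h
  have hn : n % 4 < 4 := Nat.mod_lt _ (by norm_num)
  have hn3 : n % 4 = 3 := by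
    by_contra hne
    have : n % 4 = 0 ∨ n % 4 = 1 ∨ n % 4 = 2 := by omega
    rcases this with h1 | h1 | h1
    · rw [Nat.pow_mod, h1, zero_pow h0] at h; simp at h
    · rw [Nat.pow_mod, h1, one_pow] at h; simp at h
    · have h2 : 2 ∣ n ^ k := dvd_pow (by omega) h0
      omega
  refine ⟨hn3, ?_⟩
  by_contra hk
  rw [Nat.pow_mod_four_of_three_of_even hn3 (Nat.not_odd_iff_even.mp hk)] at h
  omega

/-- For `p = 2`, the `2`-adic valuations of `b ^ y - 1` at an odd and an even `y` differ. -/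
lemma false_of_zero_even_odd_two {b c z w s x₂ x₃ : ℕ} (hb : 1 < b) (hb2 : Odd b)
    (hz : 0 < z) (hw : Odd w) (h₁ : 2 ^ s = 1 + c) (h₂ : 2 ^ x₂ = b ^ (2 * z) + c)
    (h₃ : 2 ^ x₃ = b ^ w + c) : False := by
  have hmono : ∀ {x y : ℕ}, 0 < y → 2 ^ x = b ^ y + c → s < x := by
    intro x y hy h
    have : 1 < b ^ y := Nat.one_lt_pow hy.ne' hb
    exact (Nat.pow_lt_pow_iff_right one_lt_two).mp (by omega)
  have h₁' : (2 : ℤ) ^ s = 1 + c := by exact_mod_cast h₁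
  have h₂' : (2 : ℤ) ^ x₂ = (b : ℤ) ^ (2 * z) + c := by exact_mod_cast h₂
  have h₃' : (2 : ℤ) ^ x₃ = (b : ℤ) ^ w + c := by exact_mod_cast h₃
  have h2b : (2 : ℤ) ∣ (b : ℤ) - 1 := by
    obtain ⟨j, rfl⟩ := hb2
    exact ⟨j, by push_cast; ring⟩
  have hs : (2 : ℤ) ^ s ∣ (b : ℤ) - 1 := by
    have h4 := Commute.geom_sum₂_mul (Commute.all (b : ℤ) 1) w
    have h5 : ¬ (2 : ℤ) ∣ ∑ i ∈ Finset.range w, (b : ℤ) ^ i * 1 ^ (w - 1 - i) := by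
      rw [dvd_geom_sum₂_iff_of_dvd_sub h2b, one_pow, mul_one]
      rcases hw with ⟨j, rfl⟩
      omega
    have h6 : (2 : ℤ) ^ s ∣
        (∑ i ∈ Finset.range w, (b : ℤ) ^ i * 1 ^ (w - 1 - i)) * ((b : ℤ) - 1) := by
      rw [h4, one_pow, show (b : ℤ) ^ w - 1 = 2 ^ x₃ - 2 ^ s by linarith]
      exact dvd_sub (pow_dvd_pow _ (hmono hw.pos h₃).le) dvd_rfl
    exact (((Prime.coprime_iff_not_dvd Int.prime_two).mpr h5).pow_left).dvd_of_dvd_mul_left h6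
  have h4 : (2 : ℤ) ^ (s + 1) ∣ 2 ^ x₂ - 2 ^ s := by
    rw [show (2 : ℤ) ^ x₂ - 2 ^ s = ((b : ℤ) ^ 2) ^ z - 1 ^ z by rw [← pow_mul, one_pow]; linarith]
    refine dvd_trans ?_ (sub_dvd_pow_sub_pow _ _ z)
    rw [show (b : ℤ) ^ 2 - 1 = ((b : ℤ) - 1) * (b + 1) by ring, pow_succ]
    exact mul_dvd_mul hs (by omega)
  have h5 : (2 : ℤ) ^ (s + 1) ∣ 2 ^ s :=
    (dvd_sub_right (pow_dvd_pow _ (hmono (by omega) h₂))).mp h4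
  have h6 := (pow_dvd_pow_iff (by norm_num : (2 : ℤ) ≠ 0) Int.prime_two.not_isUnit).mp h5
  omega

/-- There are no three solutions with `y` zero, positive even and odd. For odd `p` the even one is
compared with `1 + √(-c)`, that is, the descent is applied with `A = 1`. -/
lemma false_of_zero_even_odd {p b c z w s x₂ x₃ : ℕ} (hp : p.Prime) (hb : 1 < b) (hc : 1 < c)
    (hpb : ¬ p ∣ b) (hz : 0 < z) (hw : Odd w) (h₁ : p ^ s = 1 + c)
    (h₂ : p ^ x₂ = b ^ (2 * z) + c) (h₃ : p ^ x₃ = b ^ w + c) : False := by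
  by_cases hp2 : p = 2
  · subst hp2
    exact false_of_zero_even_odd_two hb
      (Nat.not_even_iff_odd.mp fun h => hpb (even_iff_two_dvd.mp h)) hz hw h₁ h₂ h₃
  have hpi : Prime (p : ℤ) := Nat.prime_iff_prime_int.mp hp
  have hpo : Odd p := hp.odd_of_ne_two hp2
  have hs : 0 < s := by
    rcases Nat.eq_zero_or_pos s with rfl | h
    · rw [pow_zero] at h₁; omega
    · exact h
  have hbw : 1 < b ^ w := Nat.one_lt_pow hw.pos.ne' hb
  have hbz : 1 < b ^ z := Nat.one_lt_pow hz.ne' hb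
  have hsx₃ : s < x₃ := (Nat.pow_lt_pow_iff_right hp.one_lt).mp (by omega)
  have hceven : Even c := by
    have h4 : Odd (1 + c) := h₁ ▸ hpo.pow
    simpa [Nat.odd_add] using h4
  have hpc : ¬ p ∣ c := fun h => hp.one_lt.ne'
    (Nat.dvd_one.mp ((Nat.dvd_add_left h).mp (h₁ ▸ dvd_pow_self p hs.ne')))
  have h₁' : (p : ℤ) ^ s = 1 + c := by exact_mod_cast h₁
  have h₂' : (p : ℤ) ^ x₂ = (b : ℤ) ^ (2 * z) + c := by exact_mod_cast h₂
  have h₃' : (p : ℤ) ^ x₃ = (b : ℤ) ^ w + c := by exact_mod_cast h₃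
  have hpbi : ¬ (p : ℤ) ∣ (b : ℤ) := by exact_mod_cast hpb
  have hpX : ¬ (p : ℤ) ∣ (b : ℤ) ^ z := fun h => hpbi (hpi.dvd_of_dvd_pow h)
  have hτ : p ≠ 2 ∧ (1 : ℤ) = 1 ∨ p = 2 ∧ (1 : ℤ) = 2 := Or.inl ⟨hp2, rfl⟩
  have hp2' : ¬ (p : ℤ) ^ s ∣ 2 := fun h => by
    have h4 : p ∣ 2 := by exact_mod_cast (dvd_pow_self (p : ℤ) hs.ne').trans h
    exact hp2 ((Nat.prime_dvd_prime_iff_eq hp Nat.prime_two).mp h4)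
  obtain ⟨k, ε, δ, hε, hδ, hk, hR, hI⟩ := eq_oddPow_of_norm (A := 1) (c := c) (X := (b : ℤ) ^ z)
    (m := x₂) hp hτ hs one_pos (by exact_mod_cast hc) hpi.not_dvd_one (by exact_mod_cast hpc)
    (by rw [h₁']; ring) (fun _ => by exact_mod_cast hceven) hpX (by rw [h₂']; ring)
  rw [one_pow, one_mul] at hR
  rw [one_pow] at hI
  have hk0 : 0 < k := by
    rcases Nat.eq_zero_or_pos k with rfl | h
    · simp only [oddPow] at hR
      have : (1 : ℤ) < (b : ℤ) ^ z := by exact_mod_cast hbz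
      omega
    · exact h
  have hsx₂ : s ≤ x₂ := by rw [hk]; exact Nat.le_mul_of_pos_left _ (by omega)
  -- the class of `b` has odd order modulo `p ^ s`, hence `b ^ z ≡ 1`
  have hbw1 : (p : ℤ) ^ s ∣ (b : ℤ) ^ w - 1 := by
    rw [show (b : ℤ) ^ w - 1 = (p : ℤ) ^ x₃ - (p : ℤ) ^ s by linarith]
    exact dvd_sub (pow_dvd_pow _ hsx₃.le) dvd_rfl
  have hbz1 : (p : ℤ) ^ s ∣ (b : ℤ) ^ z - 1 := by
    have h4 : 1 ^ 2 * (p : ℤ) ^ s ∣ ((b : ℤ) ^ z) ^ 2 - 1 ^ 2 := by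
      rw [show ((b : ℤ) ^ z) ^ 2 - 1 ^ 2 = (p : ℤ) ^ x₂ - (p : ℤ) ^ s by
        rw [h₁', h₂']; ring, one_pow, one_mul]
      exact dvd_sub (pow_dvd_pow _ hsx₂) dvd_rfl
    rcases dvd_sub_or_dvd_add_of_dvd_sq_sub_sq hp hτ hpX hpi.not_dvd_one h4 with h5 | h5
    · rwa [one_mul] at h5
    · exfalso
      rw [one_mul] at h5
      have h6 : (p : ℤ) ^ s ∣ ((b : ℤ) ^ z) ^ w - (-1) ^ w :=
        dvd_trans (by rwa [sub_neg_eq_add]) (sub_dvd_pow_sub_pow _ _ w)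
      have h7 : (p : ℤ) ^ s ∣ ((b : ℤ) ^ w) ^ z - 1 ^ z := hbw1.trans (sub_dvd_pow_sub_pow _ _ z)
      rw [hw.neg_one_pow, ← pow_mul] at h6
      rw [one_pow, ← pow_mul, mul_comm] at h7
      have h8 := dvd_sub h6 h7
      exact hp2' (by rwa [show (b : ℤ) ^ (z * w) - -1 - ((b : ℤ) ^ (z * w) - 1) = 2 by ring] at h8)
  have hRI := oddPow_one_dvd_sub c k
  rw [← h₁'] at hRI
  have hεδ : ε = δ := by
    by_contra hne
    have h4 : ε = -δ := by omega
    have h5 : δ * δ = 1 := by rcases hδ with rfl | rfl <;> norm_num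
    have h6 := dvd_sub hbz1 (hRI.mul_left ε)
    rw [show (b : ℤ) ^ z - 1 - ε * ((oddPow 1 c k).1 - (oddPow 1 c k).2) = -2 by
      rw [hR, h4]; linear_combination hI] at h6
    exact hp2' ((dvd_neg).mp h6)
  subst hεδ
  -- it remains to look at everything modulo `4`
  have hb3 : (b : ℤ) ^ z % 4 = 3 → b % 4 = 3 := fun h => by
    have h4 : ((b ^ z : ℕ) : ℤ) % 4 = 3 := by exact_mod_cast h
    exact (Nat.mod_four_of_pow_mod_four (by omega : b ^ z % 4 = 3)).1
  have hc4 : c % 4 = 0 ∨ c % 4 = 2 := by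
    obtain ⟨e, rfl⟩ := hceven
    omega
  rcases hc4 with hc4 | hc4
  · have hcI : (c : ℤ) % 4 = 0 := by omega
    rcases hε with rfl | rfl
    · exact oddPow_one_snd_ne_one hk0 (Or.inl hcI) (by linarith)
    · have hR4 := oddPow_one_mod_four_of_zero hcI k
      have hb4 := hb3 (by omega)
      have hbw4 := Nat.pow_mod_four_of_three_of_odd hb4 hw
      have hp4 := (Nat.mod_four_of_pow_mod_four (n := p) (k := x₃) (by omega)).1
      have hse : Even s := by
        by_contra hso
        have := Nat.pow_mod_four_of_three_of_odd hp4 (Nat.not_even_iff_odd.mp hso)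
        omega
      -- now `p ^ x₂` is a square larger than `(b ^ z) ^ 2`, too far from it
      obtain ⟨j, rfl⟩ := hse
      have h4 : (p ^ ((2 * k + 1) * j)) ^ 2 = (b ^ z) ^ 2 + c := by
        rw [← pow_mul, ← pow_mul, mul_comm z, ← h₂, hk]
        ring_nf
      have h5 : p ^ (j + j) ≤ p ^ ((2 * k + 1) * j) :=
        Nat.pow_le_pow_right hp.pos (by nlinarith)
      have h6 : b ^ z < p ^ ((2 * k + 1) * j) := lt_of_pow_lt_pow_left₀ 2 (by positivity) (by omega)
      nlinarith
  · have hcI : (c : ℤ) % 4 = 2 := by omega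
    obtain ⟨hI4, hR4⟩ := oddPow_one_mod_four_of_two hcI k
    obtain rfl : ε = 1 := by
      rcases hε with rfl | rfl
      · rfl
      · omega
    have hko : ¬ Even k := fun hke =>
      oddPow_one_snd_ne_one hk0 (Or.inr ⟨hcI, hke⟩) (by linarith)
    rw [if_neg hko] at hR4
    have hb4 := hb3 (by omega)
    have hbw4 := Nat.pow_mod_four_of_three_of_odd hb4 hw
    obtain ⟨hp4, hso⟩ := Nat.mod_four_of_pow_mod_four (n := p) (k := s) (by omega)
    have hx₂ : Odd x₂ := hk ▸ (odd_two_mul_add_one k).mul hso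
    have hx₃ : Even x₃ := by
      by_contra hxo
      have := Nat.pow_mod_four_of_three_of_odd hp4 (Nat.not_even_iff_odd.mp hxo)
      omega
    -- `p ^ x₂ ≡ c ≡ p ^ x₃ (mod b)`, so `p` is a square modulo `b`;
    -- likewise `b ^ w ≡ 1 (mod p)` makes `b` a square modulo `p`
    have hcop : ((p : ℤ)).gcd b = 1 := by
      rw [Int.gcd_natCast_natCast]
      exact (Nat.Prime.coprime_iff_not_dvd hp).mpr hpb
    have hcop' : ((b : ℤ)).gcd p = 1 := by rw [Int.gcd_comm]; exact hcop
    have hJ : jacobiSym p b = 1 := by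
      have h4 : jacobiSym ((p : ℤ) ^ x₂) b = jacobiSym ((p : ℤ) ^ x₃) b := by
        refine jacobiSym.mod_left' ?_
        rw [h₂', h₃']
        have : ∀ n : ℕ, 0 < n → ((b : ℤ) ^ n + c) % b = c % b := fun n hn => by
          obtain ⟨i, rfl⟩ := Nat.exists_eq_add_of_le' hn
          rw [pow_succ, add_comm, Int.add_mul_emod_self_right]
        rw [this _ (by omega), this _ hw.pos]
      rw [jacobiSym.pow_left, jacobiSym.pow_left] at h4
      rcases jacobiSym.eq_one_or_neg_one hcop with h5 | h5
      · exact h5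
      · rw [h5, hx₂.neg_one_pow, hx₃.neg_one_pow] at h4
        norm_num at h4
    have hJ' : jacobiSym b p = 1 := by
      have h4 : jacobiSym ((b : ℤ) ^ w) p = jacobiSym 1 p :=
        jacobiSym.mod_left'
          (Int.modEq_iff_dvd.mpr ((dvd_pow_self (p : ℤ) hs.ne').trans hbw1)).symm
      rw [jacobiSym.pow_left, jacobiSym.one_left] at h4
      rcases jacobiSym.eq_one_or_neg_one hcop' with h5 | h5
      · exact h5
      · rw [h5, hw.neg_one_pow] at h4
        norm_num at h4
    have hrec := jacobiSym.quadratic_reciprocity_three_mod_four hp4 hb4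
    rw [hJ, hJ'] at hrec
    norm_num at hrec

/-! ### Three solutions -/

/-- In the triples with two solutions of odd `y` other than `(2, 5, 3)`, congruences modulo `4` or `8`
leave no solution of even `y`. -/
lemma odd_of_exceptional {p b c x y : ℕ} (h : p ^ x = b ^ y + c)
    (hE : p = 13 ∧ b = 3 ∧ c = 10 ∨ p = 2 ∧ b = 3 ∧ c = 13 ∨ p = 2 ∧ b = 3 ∧ c = 5) : Odd y := by
  by_contra hy
  obtain ⟨z, rfl⟩ := even_iff_two_dvd.mp (Nat.not_odd_iff_even.mp hy)
  rw [pow_mul] at h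
  rcases hE with ⟨rfl, rfl, rfl⟩ | hE
  · have h1 : 13 ^ x % 4 = 1 := by rw [Nat.pow_mod]; norm_num
    have h2 : (3 ^ 2) ^ z % 4 = 1 := by rw [Nat.pow_mod]; norm_num
    omega
  · obtain ⟨rfl, rfl, hc⟩ : p = 2 ∧ b = 3 ∧ (c = 13 ∨ c = 5) := by tauto
    have h2 : (3 ^ 2) ^ z % 8 = 1 := by rw [Nat.pow_mod]; norm_num
    rcases Nat.lt_or_ge x 3 with hx | hx
    · interval_cases x <;> omega
    · obtain ⟨i, rfl⟩ := Nat.exists_eq_add_of_le' hx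
      rw [pow_add] at h
      omega

theorem eq_of_three_solutions {p b c x₁ x₂ x₃ y₁ y₂ y₃ : ℕ} (hp : p.Prime) (hb : 1 < b)
    (hc : 0 < c) (h12 : y₁ < y₂) (h23 : y₂ < y₃) (h₁ : p ^ x₁ = b ^ y₁ + c)
    (h₂ : p ^ x₂ = b ^ y₂ + c) (h₃ : p ^ x₃ = b ^ y₃ + c) : p = 2 ∧ b = 5 ∧ c = 3 := by
  have hpb : ¬ p ∣ b := fun h => false_of_dvd_base hp hb hc h h12 h₁ h₂
  rcases Nat.lt_or_ge 1 c with hc1 | hc1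
  swap
  · obtain rfl : c = 1 := by omega
    obtain ⟨rfl, rfl, rfl, -⟩ := eq_of_pow_eq_pow_add_one hp hb (by omega) h23 h₂ h₃
    obtain rfl : y₁ = 0 := by omega
    rcases Nat.eq_zero_or_pos x₁ with rfl | hx
    · norm_num at h₁
    · have := dvd_pow_self 3 hx.ne'
      rw [h₁] at this
      norm_num at this
  have key : ∀ {x y x' y' : ℕ}, 0 < y → y < y' → y % 2 = y' % 2 → p ^ x = b ^ y + c →
      p ^ x' = b ^ y' + c → p = 2 ∧ b = 5 ∧ c = 3 := by
    intro x y x' y' hy hyy hpar h h'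
    obtain ⟨d, rfl⟩ : ∃ d, y' = y + 2 * d := ⟨(y' - y) / 2, by omega⟩
    have hcl := (same_parity_classification hp hb hc1 hpb hy (by omega) h h').2
    by_contra hne
    have hE : p = 13 ∧ b = 3 ∧ c = 10 ∨ p = 2 ∧ b = 3 ∧ c = 13 ∨ p = 2 ∧ b = 3 ∧ c = 5 := by
      tauto
    have o₁ := odd_of_exceptional h₁ hE
    have o₂ := odd_of_exceptional h₂ hE
    have o₃ := odd_of_exceptional h₃ hE
    rw [Nat.odd_iff] at o₁ o₂ o₃
    obtain ⟨d', rfl⟩ : ∃ d, y₃ = y₂ + 2 * d := ⟨(y₃ - y₂) / 2, by omega⟩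
    have := (same_parity_classification hp hb hc1 hpb (by omega) (by omega) h₂ h₃).1
    omega
  rcases Nat.eq_zero_or_pos y₁ with rfl | hy₁
  · by_cases hpar : y₂ % 2 = y₃ % 2
    · exact key h12 h23 hpar h₂ h₃
    · exfalso
      rw [pow_zero] at h₁
      rcases Nat.mod_two_eq_zero_or_one y₂ with h | h
      · obtain ⟨z, rfl⟩ : ∃ z, y₂ = 2 * z := ⟨y₂ / 2, by omega⟩
        exact false_of_zero_even_odd hp hb hc1 hpb (by omega) (Nat.odd_iff.mpr (by omega)) h₁ h₂ h₃
      · obtain ⟨z, rfl⟩ : ∃ z, y₃ = 2 * z := ⟨y₃ / 2, by omega⟩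
        exact false_of_zero_even_odd hp hb hc1 hpb (by omega) (Nat.odd_iff.mpr h) h₁ h₃ h₂
  · rcases (by omega : y₁ % 2 = y₂ % 2 ∨ y₂ % 2 = y₃ % 2 ∨ y₁ % 2 = y₃ % 2) with h | h | h
    · exact key hy₁ h12 h h₁ h₂
    · exact key (by omega) h23 h h₂ h₃
    · exact key hy₁ (h12.trans h23) h h₁ h₃

lemma int_sub_eq_iff {a b c x y : ℕ} :
    (a : ℤ) ^ x - (b : ℤ) ^ y = (c : ℤ) ↔ a ^ x = b ^ y + c := by
  rw [sub_eq_iff_eq_add, add_comm]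
  exact_mod_cast Iff.rfl

lemma encard_solutions_le_two {a b c : ℕ} (ha : a.Prime) (hb : 1 < b) (hc : 0 < c)
    (hne : (a, b, c) ≠ (2, 5, 3)) :
    {p : ℕ × ℕ | (a : ℤ) ^ p.1 - (b : ℤ) ^ p.2 = (c : ℤ)}.encard ≤ 2 := by
  by_contra hlt
  have h3 : (3 : ℕ∞) ≤ {p : ℕ × ℕ | (a : ℤ) ^ p.1 - (b : ℤ) ^ p.2 = (c : ℤ)}.encard :=
    Order.add_one_le_of_lt (not_le.mp hlt)
  obtain ⟨t, ht, htc⟩ := Set.exists_subset_encard_eq h3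
  obtain ⟨⟨x₁, y₁⟩, ⟨x₂, y₂⟩, ⟨x₃, y₃⟩, h12, h13, h23, rfl⟩ := Set.encard_eq_three.mp htc
  have h₁ : a ^ x₁ = b ^ y₁ + c :=
    int_sub_eq_iff.mp (ht (show (x₁, y₁) ∈ _ by simp))
  have h₂ : a ^ x₂ = b ^ y₂ + c :=
    int_sub_eq_iff.mp (ht (show (x₂, y₂) ∈ _ by simp))
  have h₃ : a ^ x₃ = b ^ y₃ + c :=
    int_sub_eq_iff.mp (ht (show (x₃, y₃) ∈ _ by simp))
  have hinj : ∀ {x y x' y' : ℕ}, a ^ x = b ^ y + c → a ^ x' = b ^ y' + c → (x, y) ≠ (x', y') →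
      y ≠ y' := by
    rintro x y x' y' h h' hn rfl
    exact hn (by rw [Nat.pow_right_injective ha.two_le (h.trans h'.symm)])
  have n12 := hinj h₁ h₂ h12
  have n13 := hinj h₁ h₃ h13
  have n23 := hinj h₂ h₃ h23
  have main : a = 2 ∧ b = 5 ∧ c = 3 := by
    rcases lt_or_gt_of_ne n12 with l12 | l12 <;> rcases lt_or_gt_of_ne n13 with l13 | l13 <;>
      rcases lt_or_gt_of_ne n23 with l23 | l23
    · exact eq_of_three_solutions ha hb hc l12 l23 h₁ h₂ h₃
    · exact eq_of_three_solutions ha hb hc l13 l23 h₁ h₃ h₂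
    · omega
    · exact eq_of_three_solutions ha hb hc l13 l12 h₃ h₁ h₂
    · exact eq_of_three_solutions ha hb hc l12 l13 h₂ h₁ h₃
    · omega
    · exact eq_of_three_solutions ha hb hc l23 l13 h₂ h₃ h₁
    · exact eq_of_three_solutions ha hb hc l23 l12 h₃ h₂ h₁
  obtain ⟨rfl, rfl, rfl⟩ := main
  exact hne rfl

lemma solutions_two_five_three :
    {p : ℕ × ℕ | (2 : ℤ) ^ p.1 - (5 : ℤ) ^ p.2 = 3} = {(2, 0), (3, 1), (7, 3)} := by
  ext ⟨x, y⟩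
  simp only [Set.mem_ofPred_eq, Set.mem_insert_iff, Set.mem_singleton_iff, Prod.mk.injEq]
  constructor
  · intro h
    have h' : 2 ^ x = 5 ^ y + 3 := int_sub_eq_iff.mp (by exact_mod_cast h)
    have hinj : ∀ n, 2 ^ x = 2 ^ n → x = n := fun n hn => Nat.pow_right_injective le_rfl hn
    obtain ⟨z, rfl | rfl⟩ := Nat.even_or_odd' y
    · rw [pow_mul] at h'
      have h2 : (5 ^ 2) ^ z % 8 = 1 := by rw [Nat.pow_mod]; norm_num
      have hx : x = 2 := by
        rcases Nat.lt_or_ge x 3 with hx | hx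
        · interval_cases x <;> omega
        · obtain ⟨i, rfl⟩ := Nat.exists_eq_add_of_le' hx
          rw [pow_add] at h'
          omega
      subst hx
      have hz : z = 0 := by
        by_contra hz
        have := Nat.one_lt_pow hz (show 1 < 5 ^ 2 by norm_num)
        omega
      subst hz
      simp
    · rcases Nat.eq_zero_or_pos z with rfl | hz
      · right; left
        exact ⟨hinj 3 (by rw [h']; norm_num), rfl⟩
      · right; right
        have h8 : 2 ^ 3 = 5 ^ 1 + 3 := by norm_num
        rw [add_comm (2 * z)] at h'
        have := (same_parity_classification Nat.prime_two (by norm_num) (by norm_num)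
          (by norm_num) one_pos hz h8 h').2
        obtain rfl : z = 1 := by omega
        exact ⟨hinj 7 (by rw [h']; norm_num), rfl⟩
  · rintro (⟨rfl, rfl⟩ | ⟨rfl, rfl⟩ | ⟨rfl, rfl⟩) <;> norm_num

/-- `2 ^ 1 - b ^ 0 = 2 ^ (n + 2) - b ^ 1 = 1` for `b = 2 ^ (n + 2) - 1`. -/
lemma infinite_setOf_two_solutions : {t : ℕ × ℕ × ℕ | t.1.Prime ∧ 1 < t.2.1 ∧ 0 < t.2.2 ∧
    {p : ℕ × ℕ | (t.1 : ℤ) ^ p.1 - (t.2.1 : ℤ) ^ p.2 = (t.2.2 : ℤ)}.encard = 2}.Infinite := by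
  have hge : ∀ n : ℕ, 4 ≤ 2 ^ (n + 2) := fun n => by
    rw [pow_add]
    have : 0 < 2 ^ n := by positivity
    omega
  refine Set.infinite_of_injective_forall_mem (f := fun n : ℕ => (2, 2 ^ (n + 2) - 1, 1)) ?_ ?_
  · intro m n hmn
    simp only [Prod.mk.injEq, true_and, and_true] at hmn
    have := hge m
    have := hge n
    have h : 2 ^ (m + 2) = 2 ^ (n + 2) := by omega
    have := Nat.pow_right_injective le_rfl h
    omega
  · intro n
    have h4 := hge n
    have hb : 1 < 2 ^ (n + 2) - 1 := by omega
    refine ⟨Nat.prime_two, hb, one_pos, le_antisymm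
      (encard_solutions_le_two Nat.prime_two hb one_pos (by simp)) ?_⟩
    rw [← Set.encard_pair (show ((1, 0) : ℕ × ℕ) ≠ (n + 2, 1) by simp)]
    refine Set.encard_le_encard ?_
    rintro p (rfl | rfl)
    · exact int_sub_eq_iff.mpr (by norm_num)
    · refine int_sub_eq_iff.mpr ?_
      change 2 ^ (n + 2) = (2 ^ (n + 2) - 1) ^ 1 + 1
      rw [pow_one]
      omega

theorem theorem1 :
    (∀ a b c : ℕ, a.Prime → 1 < b → 0 < c → (a, b, c) ≠ (2, 5, 3) →
      {p : ℕ × ℕ | (a : ℤ) ^ p.1 - (b : ℤ) ^ p.2 = (c : ℤ)}.encard ≤ 2) ∧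
    {p : ℕ × ℕ | (2 : ℤ) ^ p.1 - (5 : ℤ) ^ p.2 = 3} = {(2, 0), (3, 1), (7, 3)} ∧
    {t : ℕ × ℕ × ℕ | t.1.Prime ∧ 1 < t.2.1 ∧ 0 < t.2.2 ∧
      {p : ℕ × ℕ | (t.1 : ℤ) ^ p.1 - (t.2.1 : ℤ) ^ p.2 = (t.2.2 : ℤ)}.encard = 2}.Infinite := by
  exact ⟨fun _ _ _ ha hb hc hne => encard_solutions_le_two ha hb hc hne, solutions_two_five_three,
    infinite_setOf_two_solutions⟩
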